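/- **Setting.** Let $d,K\ge 0$ be integers, let $\mathcal S,\mathcal A$ be measurable spaces and let $\phi:\mathcal S\times\mathcal A\to\mathbb R^d$ be a measurable feature map with $\|\phi(s,a)\|_2\le L$ for all $s,a$. Let $W\subseteq\mathbb R^d$ be a linear subspace, $B\in\mathbb R$, $\Theta_B=\{\theta\in W:\|\theta\|_2\le B\}$, and let $\theta^\star\in W$ with $\|\theta^\star\|_2<B$. (The main case is $W=\{\theta:\langle 1,\theta\rangle=0\}$, i.e. $\Theta_B=\{\theta\in\mathbb R^d:\langle 1,\theta\rangle=0,\ \|\theta\|_2\le B\}$; $W=\mathbb R^d$ is the case without linear constraint.) The observations $(s^i,a^i_0,\dots,a^i_{K-1},\sigma_i)$, $i=1,2,\dots$, are i.i.d.: $s^i\sim\rho$, then $(a^i_0,\dots,a^i_{K-1})\sim\mathbb P(\cdot\mid s^i)$, then the permutation $\sigma_i$ of $\{0,\dots,K-1\}$ is drawn from the Plackett–Luce model $$\mathbb P(\sigma\mid s,a_0,\dots,a_{K-1})=\prod_{j=0}^{K-1}\frac{\exp\langle\theta^\star,\phi(s,a_{\sigma(j)})\rangle}{\sum_{k=j}^{K-1}\exp\langle\theta^\star,\phi(s,a_{\sigma(k)})\rangle}.$$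 Write $\phi^i_j=\phi(s^i,a^i_{\sigma_i(j)})$ and $x^i_{jk}=\phi^i_j-\phi^i_k$. Assume identifiability on $W$: if $v\in W$ and, almost surely, $\langle v,\phi(s^i,a^i_j)-\phi(s^i,a^i_k)\rangle=0$ for all $j,k$, then $v=0$. **Estimators.** Let $\hat\theta_{\mathsf{MLE}_K}$ and $\hat\theta_{\mathsf{MLE}_2}$ be any measurable choices of minimizers over $\Theta_B$, based on the first $n$ observations, of respectively $$-\frac1n\sum_{i=1}^n\sum_{j=0}^{K-1}\log\frac{\exp\langle\theta,\phi^i_j\rangle}{\sum_{k=j}^{K-1}\exp\langle\theta,\phi^i_k\rangle},\qquad -\frac1n\sum_{i=1}^n\sum_{j=0}^{K-1}\sum_{k=j+1}^{K-1}\log\frac{\exp\langle\theta,\phi^i_j\rangle}{\exp\langle\theta,\phi^i_j\rangle+\exp\langle\theta,\phi^i_k\rangle}.$$ **Matrices.** Put $$\mathcal I(\theta^\star)=\mathbb E\Big[\sum_{j=0}^{K-1}\sum_{k=j}^{K-1}\sum_{k'=j}^{K-1}\frac{\exp\langle\theta^\star,\phi^i_k+\phi^i_{k'}\rangle}{2\big(\sum_{l=j}^{K-1}\exp\langle\theta^\star,\phi^i_l\rangle\big)^2}\,x^i_{kk'}(x^i_{kk'})^\top\Big],$$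 $$\Sigma=\mathbb E\Big[\sum_{j=0}^{K-1}\sum_{k=j}^{K-1}\frac{\exp(-\langle\theta^\star,x^i_{jk}\rangle)}{(1+\exp(-\langle\theta^\star,x^i_{jk}\rangle))^2}\,x^i_{jk}(x^i_{jk})^\top\Big],\qquad G=\sum_{j=0}^{K-1}\sum_{k=j+1}^{K-1}\frac{\exp(-\langle\theta^\star,x^i_{jk}\rangle)}{1+\exp(-\langle\theta^\star,x^i_{jk}\rangle)}\,x^i_{jk}.$$ For a matrix $M$ that is positive definite on $W$ as a quadratic form, let $M^{-1}$ denote its inverse on $W$: the inverse of $P_WM|_W:W\to W$, extended by $0$ to $W^\perp$, where $P_W$ is the orthogonal projection onto $W$. For $W=\mathbb R^d$ it is the ordinary inverse. **Theorem.** The matrices $\mathcal I(\theta^\star)$ and $\Sigma$ are positive definite on $W$ and, as $n\to\infty$, in distribution, $$\sqrt n\,(\hat\theta_{\mathsf{MLE}_K}-\theta^\star)\to\mathcal N\big(0,\mathcal I(\theta^\star)^{-1}\big),\qquad \sqrt n\,(\hat\theta_{\mathsf{MLE}_2}-\theta^\star)\to\mathcal N\big(0,\ \Sigma^{-1}\,\mathbb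 E[GG^\top]\,\Sigma^{-1}\big).$$ -/

import Mathlib

open MeasureTheory ProbabilityTheory Filter
open scoped Matrix

noncomputable section

namespace PlackettLuce

/-- Feature and parameter space `ℝ^d` with the Euclidean norm. -/
abbrev Vec (d : ℕ) : Type := EuclideanSpace ℝ (Fin d)

/-- Rankings form a finite set; every set of rankings is an event. -/
instance instMeasurableSpacePerm (K : ℕ) : MeasurableSpace (Equiv.Perm (Fin K)) := ⊤

/-- One observation `((s, (a_0, …, a_{K-1})), σ)`: a state, `K` actions, and the ranking `σ`
of the actions, where `σ 0` is the index of the most preferred action. -/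
abbrev Obs (S A : Type*) (K : ℕ) : Type _ := (S × (Fin K → A)) × Equiv.Perm (Fin K)

/-! ### Parameter set -/

/-- The parameter set `{θ ∈ W | ‖θ‖ ≤ B}` attached to a linear subspace `W` of `ℝ^d`. -/
def paramSet {d : ℕ} (W : Submodule ℝ (Vec d)) (B : ℝ) : Set (Vec d) :=
  {θ | θ ∈ W ∧ ‖θ‖ ≤ B}

/-- The hyperplane `{θ | ⟨1, θ⟩ = 0}`, where `1` is the all-ones vector. -/
def sumZero (d : ℕ) : Submodule ℝ (Vec d) where
  carrier := {θ | ∑ i, θ i = 0}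
  add_mem' := by
    intro a b ha hb
    simp only [Set.mem_ofPred_eq, PiLp.add_apply, Finset.sum_add_distrib] at *
    simp [ha, hb]
  zero_mem' := by simp
  smul_mem' := by
    intro c x hx
    simp only [Set.mem_ofPred_eq, PiLp.smul_apply, smul_eq_mul, ← Finset.mul_sum] at *
    simp [hx]

theorem mem_paramSet_sumZero {d : ℕ} (B : ℝ) (θ : Vec d) :
    θ ∈ paramSet (sumZero d) B ↔ ∑ i, θ i = 0 ∧ ‖θ‖ ≤ B := Iff.rfl

/-! ### The model -/

section Model

variable {S A : Type*} {d K : ℕ}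

/-- The linear reward `r_θ(s, a) = ⟨θ, φ(s, a)⟩`. -/
def reward (φ : S → A → Vec d) (θ : Vec d) (s : S) (a : A) : ℝ := inner ℝ θ (φ s a)

/-- Plackett-Luce probability of the ranking `σ` given the state and the actions. -/
def plProb (φ : S → A → Vec d) (θ : Vec d) (s : S) (a : Fin K → A)
    (σ : Equiv.Perm (Fin K)) : ℝ :=
  ∏ i, Real.exp (reward φ θ s (a (σ i))) /
    ∑ j ∈ Finset.Ici i, Real.exp (reward φ θ s (a (σ j)))

/-- Law of one observation: `s ∼ ρ`, then `(a_0, …, a_{K-1}) ∼ κ s`, then `σ` is drawn from the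
Plackett-Luce model with parameter `θ` given `s` and the actions. -/
def obsLaw [MeasurableSpace S] [MeasurableSpace A] (ρ : Measure S) (κ : Kernel S (Fin K → A))
    (φ : S → A → Vec d) (θ : Vec d) : Measure (Obs S A K) :=
  ∑ σ : Equiv.Perm (Fin K),
    ((ρ ⊗ₘ κ).withDensity fun x ↦ ENNReal.ofReal (plProb φ θ x.1 x.2 σ)).map fun x ↦ (x, σ)

/-- The feature of the action ranked at position `j` in the observation `z`. -/
def rankedFeature (φ : S → A → Vec d) (z : Obs S A K) (j : Fin K) : Vec d :=
  φ z.1.1 (z.1.2 (z.2 j))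

/-- Difference of the features ranked at positions `j` and `k`. -/
def rankedDiff (φ : S → A → Vec d) (z : Obs S A K) (j k : Fin K) : Vec d :=
  rankedFeature φ z j - rankedFeature φ z k

/-! ### The two losses -/

/-- Average negative Plackett-Luce log-likelihood of the observations `z 0, …, z (n - 1)`. -/
def lossK (φ : S → A → Vec d) (n : ℕ) (z : ℕ → Obs S A K) (θ : Vec d) : ℝ :=
  -(1 / (n : ℝ)) * ∑ i ∈ Finset.range n, ∑ j : Fin K,
    Real.log (Real.exp (inner ℝ θ (rankedFeature φ (z i) j)) /
      ∑ k ∈ Finset.Ici j, Real.exp (inner ℝ θ (rankedFeature φ (z i) k)))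

/-- Average negative log-likelihood after splitting each ranking into its `K (K - 1) / 2`
pairwise comparisons, treated as independent. -/
def lossPair (φ : S → A → Vec d) (n : ℕ) (z : ℕ → Obs S A K) (θ : Vec d) : ℝ :=
  -(1 / (n : ℝ)) * ∑ i ∈ Finset.range n, ∑ j : Fin K, ∑ k ∈ Finset.Ioi j,
    Real.log (Real.exp (inner ℝ θ (rankedFeature φ (z i) j)) /
      (Real.exp (inner ℝ θ (rankedFeature φ (z i) j)) +
        Real.exp (inner ℝ θ (rankedFeature φ (z i) k))))

/-! ### The matrices of the limit laws -/

/-- The rank-one matrix `x xᵀ`. -/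
def outer (x : Vec d) : Matrix (Fin d) (Fin d) ℝ := Matrix.vecMulVec x.ofLp x.ofLp

/-- Entrywise expectation of a random matrix. -/
def expMatrix {Z : Type*} [MeasurableSpace Z] (μ : Measure Z)
    (M : Z → Matrix (Fin d) (Fin d) ℝ) : Matrix (Fin d) (Fin d) ℝ :=
  Matrix.of fun p q ↦ ∫ z, M z p q ∂μ

/-- Contribution of one observation to the Plackett-Luce information; the expression is the Hessian
of the negative log-likelihood of that observation. -/
def infoK (φ : S → A → Vec d) (θ : Vec d) (z : Obs S A K) : Matrix (Fin d) (Fin d) ℝ :=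
  ∑ j : Fin K, ∑ k ∈ Finset.Ici j, ∑ k' ∈ Finset.Ici j,
    (Real.exp (inner ℝ θ (rankedFeature φ z k + rankedFeature φ z k')) /
      (2 * (∑ l ∈ Finset.Ici j, Real.exp (inner ℝ θ (rankedFeature φ z l))) ^ 2)) •
      outer (rankedDiff φ z k k')

/-- Contribution of one observation to the matrix `Σ` of the pairwise estimator. -/
def infoPair (φ : S → A → Vec d) (θ : Vec d) (z : Obs S A K) : Matrix (Fin d) (Fin d) ℝ :=
  ∑ j : Fin K, ∑ k ∈ Finset.Ici j,
    (Real.exp (-inner ℝ θ (rankedDiff φ z j k)) /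
      (1 + Real.exp (-inner ℝ θ (rankedDiff φ z j k))) ^ 2) •
      outer (rankedDiff φ z j k)

/-- The vector `G` of the pairwise estimator. -/
def scorePair (φ : S → A → Vec d) (θ : Vec d) (z : Obs S A K) : Vec d :=
  ∑ j : Fin K, ∑ k ∈ Finset.Ioi j,
    (Real.exp (-inner ℝ θ (rankedDiff φ z j k)) /
      (1 + Real.exp (-inner ℝ θ (rankedDiff φ z j k)))) •
      rankedDiff φ z j k

variable [MeasurableSpace S] [MeasurableSpace A]

/-- The Plackett-Luce Fisher information `I(θ)`. -/
def fisherInfo (ρ : Measure S) (κ : Kernel S (Fin K → A)) (φ : S → A → Vec d) (θ : Vec d) :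
    Matrix (Fin d) (Fin d) ℝ :=
  expMatrix (obsLaw ρ κ φ θ) (infoK φ θ)

/-- The matrix `Σ`. -/
def sigmaPair (ρ : Measure S) (κ : Kernel S (Fin K → A)) (φ : S → A → Vec d) (θ : Vec d) :
    Matrix (Fin d) (Fin d) ℝ :=
  expMatrix (obsLaw ρ κ φ θ) (infoPair φ θ)

/-- The matrix `E[G Gᵀ]`. -/
def scoreCovPair (ρ : Measure S) (κ : Kernel S (Fin K → A)) (φ : S → A → Vec d) (θ : Vec d) :
    Matrix (Fin d) (Fin d) ℝ :=
  expMatrix (obsLaw ρ κ φ θ) fun z ↦ outer (scorePair φ θ z)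

end Model

/-! ### Inverting a matrix on a subspace -/

section InvOn

variable {d : ℕ}

/-- The matrix of the orthogonal projection onto `W`. -/
def projMatrix (W : Submodule ℝ (Vec d)) : Matrix (Fin d) (Fin d) ℝ :=
  Matrix.toEuclideanCLM (𝕜 := ℝ) (n := Fin d) |>.symm W.starProjection

/-- `M` is positive definite as a quadratic form on `W`. -/
def PosOn (W : Submodule ℝ (Vec d)) (M : Matrix (Fin d) (Fin d) ℝ) : Prop :=
  ∀ v ∈ W, v ≠ 0 → 0 < v.ofLp ⬝ᵥ (M *ᵥ v.ofLp)

/-- The inverse of `M` on `W`: with `P` the orthogonal projection onto `W`, the inverse of the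
operator `P M : W → W`, extended by zero to the orthogonal complement of `W`. It is computed by
completing `P M P` with the identity on the complement, inverting, and compressing back.
For `W = ℝ^d` this is `M⁻¹`. -/
def invOn (W : Submodule ℝ (Vec d)) (M : Matrix (Fin d) (Fin d) ℝ) :
    Matrix (Fin d) (Fin d) ℝ :=
  projMatrix W * (projMatrix W * M * projMatrix W + (1 - projMatrix W))⁻¹ * projMatrix W

theorem projMatrix_mul_self (W : Submodule ℝ (Vec d)) :
    projMatrix W * projMatrix W = projMatrix W := by
  unfold projMatrix
  rw [← map_mul, W.isIdempotentElem_starProjection.eq]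

theorem projMatrix_transpose (W : Submodule ℝ (Vec d)) :
    (projMatrix W)ᵀ = projMatrix W := by
  have h : star (projMatrix W) = projMatrix W := by
    let F : Matrix (Fin d) (Fin d) ℝ ≃⋆ₐ[ℝ] (Vec d →L[ℝ] Vec d) := Matrix.toEuclideanCLM
    have hF : F (projMatrix W) = W.starProjection := F.apply_symm_apply _
    apply EquivLike.injective F
    rw [map_star, hF, (isSelfAdjoint_starProjection W).star_eq]
  rw [← Matrix.conjTranspose_eq_transpose_of_trivial]
  exact h

theorem projMatrix_mulVec (W : Submodule ℝ (Vec d)) (v : Vec d) :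
    projMatrix W *ᵥ v.ofLp = (W.starProjection v).ofLp := by
  have h := Matrix.ofLp_toEuclideanCLM (𝕜 := ℝ) (projMatrix W) v
  rw [← h]
  simp [projMatrix]

theorem invOn_top (M : Matrix (Fin d) (Fin d) ℝ) : invOn ⊤ M = M⁻¹ := by
  have h : projMatrix (⊤ : Submodule ℝ (Vec d)) = 1 := by
    unfold projMatrix
    rw [Submodule.starProjection_top]
    exact map_one _
  simp [invOn, h]

/-- If `M` is positive definite on `W`, then `invOn W M` is the inverse of `P M : W → W` extended
by zero: it maps into `W`, vanishes on the complement of `W`, and `P M (invOn W M) = P`. -/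
theorem invOn_spec (W : Submodule ℝ (Vec d)) (M : Matrix (Fin d) (Fin d) ℝ) (hM : PosOn W M) :
    projMatrix W * invOn W M = invOn W M ∧ invOn W M * projMatrix W = invOn W M ∧
      projMatrix W * M * invOn W M = projMatrix W := by
  have hPP := projMatrix_mul_self W
  have hPT := projMatrix_transpose W
  have hinj : ∀ w : Fin d → ℝ,
      (projMatrix W * M * projMatrix W + (1 - projMatrix W)) *ᵥ w = 0 → w = 0 := by
    intro w hw
    have h1 : (projMatrix W * M * projMatrix W) *ᵥ w = 0 := by
      have := congrArg (fun u ↦ projMatrix W *ᵥ u) hw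
      simpa [Matrix.mulVec_mulVec, mul_add, mul_sub, ← mul_assoc, hPP] using this
    have h2 : projMatrix W *ᵥ w = w := by
      rw [Matrix.add_mulVec, h1, zero_add, Matrix.sub_mulVec, Matrix.one_mulVec, sub_eq_zero] at hw
      exact hw.symm
    have hw0 : w ⬝ᵥ (M *ᵥ w) = 0 := by
      have h3 : w ᵥ* projMatrix W = w := by
        rw [← hPT, Matrix.vecMul_transpose, h2]
      have h4 : projMatrix W *ᵥ (M *ᵥ w) = 0 := by
        rw [Matrix.mulVec_mulVec]
        have := h1
        rwa [← Matrix.mulVec_mulVec, h2] at this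
      calc w ⬝ᵥ (M *ᵥ w) = (w ᵥ* projMatrix W) ⬝ᵥ (M *ᵥ w) := by rw [h3]
        _ = 0 := by rw [← Matrix.dotProduct_mulVec, h4, dotProduct_zero]
    by_contra hne
    have hmem : WithLp.toLp 2 w ∈ W := by
      have h := projMatrix_mulVec W (WithLp.toLp 2 w)
      have h' : W.starProjection (WithLp.toLp 2 w) = WithLp.toLp 2 w := by
        apply WithLp.ofLp_injective
        rw [← h]
        exact h2
      exact Submodule.starProjection_eq_self_iff.mp h'
    have := hM _ hmem (fun h0 ↦ hne (by simpa using congrArg WithLp.ofLp h0))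
    exact absurd hw0 this.ne'
  set P := projMatrix W with hP
  set N := P * M * P + (1 - P) with hN
  have hU : IsUnit N := Matrix.mulVec_injective_iff_isUnit.mp fun x y hxy ↦ by
    have := hinj (x - y) (by rw [Matrix.mulVec_sub]; exact sub_eq_zero.mpr hxy)
    exact sub_eq_zero.mp this
  have hdet : IsUnit N.det := (Matrix.isUnit_iff_isUnit_det N).mp hU
  have hNP : N * P = P * M * P := by rw [hN]; simp [add_mul, sub_mul, mul_assoc, hPP]
  have hPN : P * N = P * M * P := by rw [hN]; simp [mul_add, mul_sub, ← mul_assoc, hPP]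
  have hcomm : N⁻¹ * P = P * N⁻¹ := by
    calc N⁻¹ * P = N⁻¹ * (P * N) * N⁻¹ := by
          rw [mul_assoc, mul_assoc, Matrix.mul_nonsing_inv _ hdet, mul_one]
      _ = N⁻¹ * (N * P) * N⁻¹ := by rw [hPN, hNP]
      _ = P * N⁻¹ := by rw [← mul_assoc, Matrix.nonsing_inv_mul _ hdet, one_mul]
  have hdef : invOn W M = P * N⁻¹ * P := rfl
  refine ⟨?_, ?_, ?_⟩
  · rw [hdef, ← mul_assoc, ← mul_assoc, hPP]
  · rw [hdef, mul_assoc, hPP]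
  · rw [hdef, mul_assoc P N⁻¹, hcomm, ← mul_assoc P P, hPP, ← mul_assoc, ← hNP, mul_assoc, ← hcomm,
      ← mul_assoc, Matrix.mul_nonsing_inv _ hdet, one_mul]

end InvOn

end PlackettLuce

end

open PlackettLuce

/-! Both objectives are sums of choice losses `log ∑_{k ∈ s} exp⟨θ, x_k⟩ - ⟨θ, x_w⟩`, where the item
`w` wins the block `s`. The full likelihood uses the blocks of positions `≥ j`, the pairwise one the
blocks `{j, k}`. These losses are convex in `θ`. The derivatives of log-sum-exp along a line are
cumulants of a bounded variable, so the quadratic Taylor expansion at `θ⋆` has a cubic remainder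
that is uniform in the observation.

This puts both estimators under one theorem on convex M-estimators,
`tendstoInDistribution_of_convex_minimizer`. In the coordinate `h = √n (θ - θ⋆)` the increment of
the total loss is `⟨U, h⟩ + ⟨h, V h⟩ / 2` up to an error that is small in probability on bounded
sets. Here `U` is the normalized sum of scores and `V` the expected Hessian. The quadratic is
minimized over `W` at `α = -V⁻¹ U`. By convexity a minimizer of the loss cannot be far from `α`
(`norm_sub_lt_of_isMinOn_of_approx`), so no separate consistency proof is needed. Since `‖θ⋆‖ < B`,
the ball constraint does not exclude `α` when `n` is large and `α` stays bounded. The central limit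
theorem for `α` gives the sandwich covariance `V⁻¹ J V⁻¹`, with `J` the covariance of the score.

The model enters in three places. Every ranking has positive probability and every pair of positions
shares a block, so identifiability makes `V` positive definite on `W`. For the full likelihood,
differentiating `∑ P(σ) = 1` twice gives a centered score and `J = V`, and the sandwich collapses to
`V⁻¹`. For the pairwise loss the score is still centered, because the Plackett-Luce model ranks `a`
before `b` with odds `w a : w b` (`sum_plWeight_mul_pair`), and `E[G Gᵀ]` is kept as `J`. -/

/-! ### Convexity, the central limit theorem and quadratic forms -/

/-- A convex function that is uniformly close, near `α`, to a function growing quadratically away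
from `α` has its minimizers near `α`. -/
theorem norm_sub_lt_of_isMinOn_of_approx {E : Type*} [NormedAddCommGroup E] [NormedSpace ℝ E]
    {C : Set E} {A q : E → ℝ} (hA : ConvexOn ℝ C A) {x α : E} (hx : x ∈ C) (hα : α ∈ C)
    (hmin : IsMinOn A C x) {ε δ c : ℝ} (hε : 0 < ε) (hδ : 2 * δ < c * ε ^ 2)
    (happ : ∀ h ∈ C, ‖h - α‖ ≤ ε → |A h - q h| ≤ δ)
    (hq : ∀ h ∈ C, q α + c * ‖h - α‖ ^ 2 ≤ q h) : ‖x - α‖ < ε := by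
  by_contra! hcon
  have hpos : 0 < ‖x - α‖ := hε.trans_le hcon
  -- The point `h` where the segment from `α` to `x` crosses the sphere of radius `ε` gives the
  -- contradiction. Convexity and `A x ≤ A α` give `A h ≤ A α`, while the growth of `q` gives `A h ≥
  -- A α + c ε² - 2δ`.
  set t := ε / ‖x - α‖ with ht
  have ht0 : 0 ≤ t := by positivity
  have ht1 : t ≤ 1 := (div_le_one hpos).2 hcon
  set h := (1 - t) • α + t • x with hh
  have hhC : h ∈ C := hA.1 hα hx (by linarith) ht0 (by ring)
  have hn : ‖h - α‖ = ε := by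
    have : h - α = t • (x - α) := by rw [hh]; module
    rw [this, norm_smul, Real.norm_of_nonneg ht0, ht, div_mul_cancel₀ _ hpos.ne']
  have h1 : A h ≤ (1 - t) * A α + t * A x := by
    simpa using hA.2 hα hx (by linarith : 0 ≤ 1 - t) ht0 (by ring)
  have h2 : A x ≤ A α := hmin hα
  have h3 := abs_le.1 (happ h hhC hn.le)
  have h4 := abs_le.1 (happ α hα (by simpa using hε.le))
  have h5 := hq h hhC
  rw [hn] at h5
  have h6 : t * A x ≤ t * A α := mul_le_mul_of_nonneg_left h2 ht0
  linarith [h3.1, h4.2]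

/-- Central limit theorem in `ℝ^d` for centered bounded functions of independent observations. -/
theorem tendstoInDistribution_inv_sqrt_smul_sum {d : ℕ} {𝒵 : Type*} [MeasurableSpace 𝒵]
    {μ : Measure 𝒵} {Ω : Type*} [MeasurableSpace Ω] {P : Measure Ω} [IsProbabilityMeasure P]
    {Z : ℕ → Ω → 𝒵} (hZ : ∀ i, HasLaw (Z i) μ P) (hindep : iIndepFun Z P)
    {a : 𝒵 → Vec d} (ha : Measurable a) {C : ℝ} (haC : ∀ z, ‖a z‖ ≤ C)
    (hmean : ∀ t : Vec d, ∫ z, inner ℝ t (a z) ∂μ = 0)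
    {S : Matrix (Fin d) (Fin d) ℝ} (hS : S.PosSemidef)
    (hcov : ∀ t : Vec d, t.ofLp ⬝ᵥ (S *ᵥ t.ofLp) = ∫ z, (inner ℝ t (a z)) ^ 2 ∂μ) :
    TendstoInDistribution (fun (n : ℕ) ω ↦ (Real.sqrt n)⁻¹ • ∑ i ∈ Finset.range n, a (Z i ω))
      atTop id (fun _ ↦ P) (multivariateGaussian 0 S) := by
  have hm : ∀ i, AEMeasurable (fun ω ↦ a (Z i ω)) P := fun i ↦
    ha.comp_aemeasurable (hZ i).aemeasurable
  have hXm : ∀ n : ℕ, AEMeasurable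
      (fun ω ↦ (Real.sqrt n)⁻¹ • ∑ i ∈ Finset.range n, a (Z i ω)) P := fun n ↦
    (Finset.aemeasurable_fun_sum _ fun i _ ↦ hm i).fun_const_smul _
  refine ⟨hXm, aemeasurable_id, ProbabilityMeasure.tendsto_iff_tendsto_charFun.2 fun t ↦ ?_⟩
  have hta : Measurable fun z ↦ inner ℝ t (a z) := by fun_prop
  set X : ℕ → Ω → ℝ := fun i ω ↦ inner ℝ t (a (Z i ω)) with hX
  have hXind : iIndepFun X P := hindep.comp (fun _ z ↦ inner ℝ t (a z)) fun _ ↦ hta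
  have hident : ∀ i, IdentDistrib (X i) (X 0) P P := fun i ↦ by
    have : IdentDistrib (Z i) (Z 0) P P :=
      ⟨(hZ i).aemeasurable, (hZ 0).aemeasurable, by rw [(hZ i).map_eq, (hZ 0).map_eq]⟩
    exact this.comp hta
  have hX2 : MemLp (X 0) 2 P := by
    refine MemLp.of_bound (hta.comp_aemeasurable (hZ 0).aemeasurable).aestronglyMeasurable
      (‖t‖ * C) (.of_forall fun ω ↦ ?_)
    exact (norm_inner_le_norm _ _).trans (by gcongr; exact haC _)
  have hE : P[X 0] = 0 := by
    rw [← hmean t]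
    exact (hZ 0).integral_comp hta.aestronglyMeasurable
  have hVar : Var[X 0; P] = t.ofLp ⬝ᵥ (S *ᵥ t.ofLp) := by
    rw [variance_eq_integral hX2.1.aemeasurable, hE, hcov]
    simp only [sub_zero]
    exact (hZ 0).integral_comp (f := fun z ↦ (inner ℝ t (a z)) ^ 2)
      (by fun_prop)
  have hclt := tendstoInDistribution_inv_sqrt_mul_sum_sub (Y := id)
    (P' := gaussianReal 0 Var[X 0; P].toNNReal) HasLaw.id hX2 hXind hident
  -- Cramér-Wold: the direction `t` is already absorbed in the scalar variables `X i`, so the scalar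
  -- theorem is needed only at frequency `1`.
  have hch := ProbabilityMeasure.tendsto_iff_tendsto_charFun.1 hclt.tendsto 1
  simp only [hE, ProbabilityMeasure.coe_mk, Measure.map_id, charFun_gaussianReal,
    charFun_multivariateGaussian hS] at hch ⊢
  convert! hch using 2
  · rename_i n
    rw [charFun_apply, charFun_apply, integral_map (hXm n) (by fun_prop),
      integral_map (by simpa only [hE] using hclt.forall_aemeasurable n) (by fun_prop)]
    refine integral_congr_ae (.of_forall fun ω ↦ ?_)
    simp [hX, inner_smul_left, sum_inner, real_inner_comm]
  · rw [← hVar, Real.coe_toNNReal _ (variance_nonneg _ _)]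
    simp

/-- A quadratic form that is positive on a subspace is bounded below by a multiple of `‖v‖ ^ 2`. -/
theorem PlackettLuce.PosOn.exists_pos_le {d : ℕ} {W : Submodule ℝ (Vec d)}
    {M : Matrix (Fin d) (Fin d) ℝ} (hM : PosOn W M) :
    ∃ c > 0, ∀ v ∈ W, c * ‖v‖ ^ 2 ≤ v.ofLp ⬝ᵥ (M *ᵥ v.ofLp) := by
  have hcont : Continuous fun v : Vec d ↦ v.ofLp ⬝ᵥ (M *ᵥ v.ofLp) := by
    have h : (fun v : Vec d ↦ v.ofLp ⬝ᵥ (M *ᵥ v.ofLp)) =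
        fun v ↦ inner ℝ v (Matrix.toEuclideanCLM (𝕜 := ℝ) M v) := by
      ext v; simp [Matrix.inner_toEuclideanCLM]
    rw [h]; fun_prop
  have hcomp : IsCompact ((W : Set (Vec d)) ∩ Metric.sphere 0 1) :=
    (isCompact_sphere 0 1).inter_left W.closed_of_finiteDimensional
  -- An empty unit sphere means `W = 0`, where any constant works; otherwise the minimum over the
  -- compact sphere is the constant.
  rcases ((W : Set (Vec d)) ∩ Metric.sphere 0 1).eq_empty_or_nonempty with he | hne
  · refine ⟨1, one_pos, fun v hv ↦ ?_⟩
    have : v = 0 := by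
      by_contra h0
      have : ‖v‖⁻¹ • v ∈ (W : Set (Vec d)) ∩ Metric.sphere 0 1 :=
        ⟨W.smul_mem _ hv, by simp [norm_smul, h0]⟩
      rw [he] at this
      exact this
    simp [this]
  · obtain ⟨u, hu, hmin⟩ := hcomp.exists_isMinOn hne hcont.continuousOn
    have hu0 : u ≠ 0 := by rintro rfl; simpa using hu.2
    refine ⟨_, hM u hu.1 hu0, fun v hv ↦ ?_⟩
    rcases eq_or_ne v 0 with rfl | h0
    · simp
    have hn : 0 < ‖v‖ := norm_pos_iff.2 h0
    have := hmin (a := ‖v‖⁻¹ • v) ⟨W.smul_mem _ hv, by simp [norm_smul, h0]⟩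
    simp only [Set.mem_ofPred_eq, WithLp.ofLp_smul, Matrix.mulVec_smul, dotProduct_smul,
      smul_dotProduct, smul_eq_mul] at this
    have h2 := mul_le_mul_of_nonneg_right this (sq_nonneg ‖v‖)
    refine h2.trans_eq ?_
    field_simp

theorem abs_dotProduct_mulVec_le {d : ℕ} (M : Matrix (Fin d) (Fin d) ℝ) (h : Vec d) :
    |h.ofLp ⬝ᵥ (M *ᵥ h.ofLp)| ≤ (∑ p, ∑ q, |M p q|) * ‖h‖ ^ 2 := by
  have hc : ∀ p, |h p| ≤ ‖h‖ := fun p ↦ by simpa using PiLp.norm_apply_le h p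
  simp only [dotProduct, Matrix.mulVec, Finset.mul_sum, Finset.sum_mul]
  refine (Finset.abs_sum_le_sum_abs _ _).trans (Finset.sum_le_sum fun p _ ↦ ?_)
  refine (Finset.abs_sum_le_sum_abs _ _).trans (Finset.sum_le_sum fun q _ ↦ ?_)
  rw [abs_mul, abs_mul]
  calc |h p| * (|M p q| * |h q|) ≤ ‖h‖ * (|M p q| * ‖h‖) := by gcongr <;> exact hc _
    _ = |M p q| * ‖h‖ ^ 2 := by ring

theorem inner_toEuclideanCLM_of_isSymm {d : ℕ} {M : Matrix (Fin d) (Fin d) ℝ} (hM : M.IsSymm)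
    (x y : Vec d) : inner ℝ x (Matrix.toEuclideanCLM (𝕜 := ℝ) M y) =
      inner ℝ (Matrix.toEuclideanCLM (𝕜 := ℝ) M x) y := by
  rw [real_inner_comm y, Matrix.inner_toEuclideanCLM, Matrix.inner_toEuclideanCLM]
  rw [Matrix.dotProduct_mulVec, ← Matrix.mulVec_transpose, hM.eq, dotProduct_comm]

/-! ### Inverse on a subspace, and asymptotic normality of convex M-estimators -/

namespace PlackettLuce

theorem convex_paramSet {d : ℕ} (W : Submodule ℝ (Vec d)) (B : ℝ) : Convex ℝ (paramSet W B) := by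
  have : paramSet W B = (W : Set (Vec d)) ∩ Metric.closedBall 0 B := by
    ext θ; simp [paramSet]
  rw [this]
  exact W.convex.inter (convex_closedBall 0 B)

theorem isSymm_invOn {d : ℕ} (W : Submodule ℝ (Vec d)) {M : Matrix (Fin d) (Fin d) ℝ}
    (hM : M.IsSymm) : (invOn W M).IsSymm := by
  unfold invOn Matrix.IsSymm
  simp only [Matrix.transpose_mul, Matrix.transpose_nonsing_inv, Matrix.transpose_add,
    Matrix.transpose_sub, Matrix.transpose_one, projMatrix_transpose, hM.eq, mul_assoc]

theorem toEuclideanCLM_projMatrix {d : ℕ} (W : Submodule ℝ (Vec d)) :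
    Matrix.toEuclideanCLM (𝕜 := ℝ) (projMatrix W) = W.starProjection := by
  simp [projMatrix]

theorem toEuclideanCLM_invOn_mem {d : ℕ} {W : Submodule ℝ (Vec d)}
    {M : Matrix (Fin d) (Fin d) ℝ} (hM : PosOn W M) (v : Vec d) :
    Matrix.toEuclideanCLM (𝕜 := ℝ) (invOn W M) v ∈ W := by
  rw [← (invOn_spec W M hM).1, map_mul, toEuclideanCLM_projMatrix]
  exact W.starProjection_apply_mem _

/-- `M (invOn W M u) - u` is orthogonal to `W`. -/
theorem inner_toEuclideanCLM_invOn {d : ℕ} {W : Submodule ℝ (Vec d)}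
    {M : Matrix (Fin d) (Fin d) ℝ} (hM : PosOn W M) (u : Vec d) {w : Vec d} (hw : w ∈ W) :
    inner ℝ w (Matrix.toEuclideanCLM (𝕜 := ℝ) M (Matrix.toEuclideanCLM (𝕜 := ℝ) (invOn W M) u)) =
      inner ℝ w u := by
  have h := congrArg (fun N ↦ Matrix.toEuclideanCLM (𝕜 := ℝ) N u) (invOn_spec W M hM).2.2
  simp only [map_mul, toEuclideanCLM_projMatrix, mul_apply_eq_comp] at h
  have h1 : ∀ y, inner ℝ w (W.starProjection y) = inner ℝ w y := fun y ↦ by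
    rw [← W.inner_starProjection_left_eq_right, Submodule.starProjection_eq_self_iff.2 hw]
  rw [← h1, h, h1]

/-- If `M` is symmetric and positive definite on `W`, then `invOn W M * M * invOn W M` is
`invOn W M`. -/
theorem invOn_mul_mul_invOn {d : ℕ} {W : Submodule ℝ (Vec d)} {M : Matrix (Fin d) (Fin d) ℝ}
    (hM : PosOn W M) : invOn W M * M * invOn W M = invOn W M := by
  obtain ⟨-, h2, h3⟩ := invOn_spec W M hM
  calc invOn W M * M * invOn W M = invOn W M * projMatrix W * M * invOn W M := by rw [h2]
    _ = invOn W M * (projMatrix W * M * invOn W M) := by simp only [mul_assoc]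
    _ = invOn W M := by rw [h3, h2]

/-- Comparison of the minimizer of a sum of convex losses with its linearization, on one sample. -/
theorem norm_sqrt_smul_sub_sub_lt {d : ℕ} {𝒵 : Type*}
    {W : Submodule ℝ (Vec d)} {B : ℝ} {θ₀ : Vec d} (hθW : θ₀ ∈ W)
    {ℓ : 𝒵 → Vec d → ℝ} (hconv : ∀ z, ConvexOn ℝ Set.univ (ℓ z))
    {ψ : 𝒵 → Vec d} {H : 𝒵 → Matrix (Fin d) (Fin d) ℝ} {D : ℝ} (hD : 0 ≤ D)
    (htaylor : ∀ z h, |ℓ z (θ₀ + h) - ℓ z θ₀ -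
      (inner ℝ (ψ z) h + h.ofLp ⬝ᵥ (H z *ᵥ h.ofLp) / 2)| ≤ D * ‖h‖ ^ 3)
    {V : Matrix (Fin d) (Fin d) ℝ} (hV : V.IsSymm) (hpos : PosOn W V)
    {c : ℝ} (hc : ∀ v ∈ W, c * ‖v‖ ^ 2 ≤ v.ofLp ⬝ᵥ (V *ᵥ v.ofLp))
    {n : ℕ} (hn : 0 < n) (z : ℕ → 𝒵) {θ : Vec d} (hθ : θ ∈ paramSet W B)
    (hmin : IsMinOn (fun θ ↦ ∑ i ∈ Finset.range n, ℓ (z i) θ) (paramSet W B) θ)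
    {α : Vec d} (hα : α = (Real.sqrt n)⁻¹ • ∑ i ∈ Finset.range n,
      -Matrix.toEuclideanCLM (𝕜 := ℝ) (invOn W V) (ψ (z i)))
    {R ε δ : ℝ} (hε : 0 < ε) (hαR : ‖α‖ ≤ R) (hR : ‖θ₀‖ + R / Real.sqrt n ≤ B)
    (hΔ : (∑ p, ∑ q, |(∑ i ∈ Finset.range n, H (z i) p q) / n - V p q|) * (R + ε) ^ 2 / 2 +
      D * (R + ε) ^ 3 / Real.sqrt n ≤ δ)
    (hδ : 2 * δ < c / 2 * ε ^ 2) :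
    ‖Real.sqrt n • (θ - θ₀) - α‖ < ε := by
  set T : Matrix (Fin d) (Fin d) ℝ → Vec d → Vec d := fun M v ↦
    Matrix.toEuclideanCLM (𝕜 := ℝ) M v with hT
  have hquad : ∀ M (v : Vec d), v.ofLp ⬝ᵥ (M *ᵥ v.ofLp) = inner ℝ v (T M v) := fun M v ↦ by
    simp [hT, Matrix.inner_toEuclideanCLM]
  have hs : 0 < Real.sqrt n := Real.sqrt_pos.2 (by exact_mod_cast hn)
  have hs2 : Real.sqrt n * Real.sqrt n = n := Real.mul_self_sqrt (by positivity)
  set s := Real.sqrt n with hsdef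
  set U : Vec d := s⁻¹ • ∑ i ∈ Finset.range n, ψ (z i) with hU
  have hαU : α = -T (invOn W V) U := by
    rw [hα, hU, hT]
    simp only [map_smul, map_sum, Finset.sum_neg_distrib, smul_neg]
  have hαW : α ∈ W := by
    rw [hαU]; exact W.neg_mem (toEuclideanCLM_invOn_mem hpos U)
  -- Local coordinates `h = √n (θ - θ₀)`: `C` is the rescaled parameter set, `A` the increment of
  -- the total loss, and `q` its quadratic model, with the sample Hessian replaced by `V`.
  set C : Set (Vec d) := {h | θ₀ + s⁻¹ • h ∈ paramSet W B} with hC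
  have hCW : ∀ h ∈ C, h ∈ W := fun h hh ↦ by
    have h1 : θ₀ + s⁻¹ • h ∈ W := hh.1
    have h2 := (W.add_mem_iff_right hθW).1 h1
    exact (W.smul_mem_iff (inv_ne_zero hs.ne')).1 h2
  set A : Vec d → ℝ := fun h ↦
    ∑ i ∈ Finset.range n, (ℓ (z i) (θ₀ + s⁻¹ • h) - ℓ (z i) θ₀) with hAdef
  set q : Vec d → ℝ := fun h ↦ inner ℝ U h + inner ℝ h (T V h) / 2 with hq
  have hCconv : Convex ℝ C := by
    intro x hx y hy a b ha hb hab
    have := convex_paramSet W B hx hy ha hb hab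
    simp only [hC, Set.mem_ofPred_eq]
    convert this using 1
    have : θ₀ = (a + b) • θ₀ := by rw [hab, one_smul]
    nth_rewrite 1 [this]
    module
  have hAconv : ConvexOn ℝ C A := by
    refine ⟨hCconv, fun x hx y hy a b ha hb hab ↦ ?_⟩
    simp only [hAdef, smul_eq_mul, Finset.mul_sum, ← Finset.sum_add_distrib]
    refine Finset.sum_le_sum fun i _ ↦ ?_
    have h1 := (hconv (z i)).2 (Set.mem_univ (θ₀ + s⁻¹ • x)) (Set.mem_univ (θ₀ + s⁻¹ • y)) ha hb hab
    have h2 : θ₀ + s⁻¹ • (a • x + b • y) = a • (θ₀ + s⁻¹ • x) + b • (θ₀ + s⁻¹ • y) := by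
      have : θ₀ = (a + b) • θ₀ := by rw [hab, one_smul]
      nth_rewrite 1 [this]
      module
    rw [h2]
    have h3 : ℓ (z i) θ₀ = a * ℓ (z i) θ₀ + b * ℓ (z i) θ₀ := by rw [← add_mul, hab, one_mul]
    simp only [smul_eq_mul] at h1
    linarith
  have hxeq : θ₀ + s⁻¹ • (s • (θ - θ₀)) = θ := by
    rw [smul_smul, inv_mul_cancel₀ hs.ne', one_smul, add_sub_cancel]
  refine norm_sub_lt_of_isMinOn_of_approx (q := q) hAconv ?_ ?_ ?_ hε hδ ?_ ?_
  · rw [hC, Set.mem_ofPred_eq, hxeq]; exact hθ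
  -- The comparison point `α` must itself be feasible; `hR` leaves the room for this inside the
  -- ball.
  · refine ⟨W.add_mem hθW (W.smul_mem _ hαW), (norm_add_le _ _).trans ?_⟩
    rw [norm_smul, norm_inv, Real.norm_of_nonneg hs.le, inv_mul_eq_div]
    refine le_trans ?_ hR
    gcongr
  · intro h hh
    have := hmin hh
    simp only [Set.mem_ofPred_eq, hAdef, Finset.sum_sub_distrib, hxeq] at this ⊢
    linarith
  · intro h hh hdist
    have hhn : ‖h‖ ≤ R + ε := by
      calc ‖h‖ = ‖α + (h - α)‖ := by rw [add_sub_cancel]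
        _ ≤ ‖α‖ + ‖h - α‖ := norm_add_le _ _
        _ ≤ R + ε := by gcongr
    have hR0 : 0 ≤ R + ε := (norm_nonneg h).trans hhn
    set M : Matrix (Fin d) (Fin d) ℝ :=
      Matrix.of fun p q ↦ (∑ i ∈ Finset.range n, H (z i) p q) / n - V p q with hM
    have hMV : M = (n : ℝ)⁻¹ • (∑ i ∈ Finset.range n, H (z i)) - V := by
      ext p q
      simp [hM, Matrix.sum_apply]; ring
    -- The error has two sources: `n` cubic remainders at scale `‖h‖ / √n`, in total at most `D ‖h‖³
    -- / √n`, and half the quadratic form of the empirical Hessian minus `V`.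
    have hsplit : A h - q h = ∑ i ∈ Finset.range n, (ℓ (z i) (θ₀ + s⁻¹ • h) - ℓ (z i) θ₀ -
        (inner ℝ (ψ (z i)) (s⁻¹ • h) +
          (s⁻¹ • h).ofLp ⬝ᵥ (H (z i) *ᵥ (s⁻¹ • h).ofLp) / 2)) +
          (h.ofLp ⬝ᵥ (M *ᵥ h.ofLp)) / 2 := by
      have e1 : inner ℝ U h = ∑ i ∈ Finset.range n, inner ℝ (ψ (z i)) (s⁻¹ • h) := by
        simp [hU, inner_smul_left, inner_smul_right, sum_inner, Finset.mul_sum]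
      have e2 : h.ofLp ⬝ᵥ (M *ᵥ h.ofLp) = ∑ i ∈ Finset.range n,
          (s⁻¹ • h).ofLp ⬝ᵥ (H (z i) *ᵥ (s⁻¹ • h).ofLp) - inner ℝ h (T V h) := by
        rw [← hquad, hMV, Matrix.sub_mulVec, dotProduct_sub, Matrix.smul_mulVec,
          Matrix.sum_mulVec, dotProduct_smul, dotProduct_sum, smul_eq_mul, Finset.mul_sum]
        congr 1
        refine Finset.sum_congr rfl fun i _ ↦ ?_
        simp only [WithLp.ofLp_smul, Matrix.mulVec_smul, dotProduct_smul,
          smul_dotProduct, smul_eq_mul, ← hs2]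
        field_simp
      simp only [hAdef, hq, e1, e2, Finset.sum_sub_distrib, Finset.sum_add_distrib]
      rw [sub_div, Finset.sum_div]
      ring
    rw [hsplit]
    refine (abs_add_le _ _).trans (le_trans ?_ hΔ)
    rw [add_comm]
    refine add_le_add ?_ ?_
    · rw [abs_div, abs_two]
      have := abs_dotProduct_mulVec_le M h
      simp only [hM, Matrix.of_apply] at this
      gcongr
      refine this.trans ?_
      gcongr
    · refine (Finset.abs_sum_le_sum_abs _ _).trans ?_
      refine (Finset.sum_le_sum fun i _ ↦ htaylor (z i) (s⁻¹ • h)).trans ?_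
      rw [Finset.sum_const, Finset.card_range, nsmul_eq_mul, norm_smul, norm_inv,
        Real.norm_of_nonneg hs.le, ← hs2]
      calc s * s * (D * (s⁻¹ * ‖h‖) ^ 3) = D * ‖h‖ ^ 3 / s := by field_simp
        _ ≤ D * (R + ε) ^ 3 / s := by gcongr
  · intro h hh
    -- Completing the square on `W`: `V α + U` is orthogonal to `h - α`, so `q h - q α = ⟨h - α, V
    -- (h - α)⟩ / 2`. Hence the constant `c / 2`.
    have hd : h - α ∈ W := W.sub_mem (hCW h hh) hαW
    have h1 := hc _ hd
    rw [hquad] at h1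
    have h2 := inner_toEuclideanCLM_invOn hpos U hd
    have h3 : inner ℝ (h - α) (T V α) = - inner ℝ (h - α) U := by
      rw [← h2, hαU]; simp [hT]
    have h4 : inner ℝ α (T V h) = inner ℝ h (T V α) := by
      simp only [hT]
      rw [inner_toEuclideanCLM_of_isSymm hV, real_inner_comm]
    have h5 : T V (h - α) = T V h - T V α := by simp [hT]
    have hUh : inner ℝ U h = inner ℝ h U := real_inner_comm _ _
    have hUα : inner ℝ U α = inner ℝ α U := real_inner_comm _ _
    rw [h5] at h1
    simp only [inner_sub_left, inner_sub_right] at h1 h3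
    simp only [hq]
    linarith

theorem isSymm_invOn_mul_mul_invOn {d : ℕ} (W : Submodule ℝ (Vec d))
    {M J : Matrix (Fin d) (Fin d) ℝ} (hM : M.IsSymm) (hJ : J.IsSymm) :
    (invOn W M * J * invOn W M).IsSymm := by
  have := (isSymm_invOn W hM).eq
  unfold Matrix.IsSymm
  rw [Matrix.transpose_mul, Matrix.transpose_mul, this, hJ.eq, mul_assoc]

/-- **Asymptotic normality of constrained convex M-estimators.** The parameter set is a ball in a
subspace `W`, the true parameter is in its relative interior, and the losses are convex with
bounded score, bounded Hessian and a uniform cubic Taylor remainder at the true parameter. -/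
theorem tendstoInDistribution_of_convex_minimizer {d : ℕ} {𝒵 : Type*} [MeasurableSpace 𝒵]
    {μ : Measure 𝒵} {Ω : Type*} [MeasurableSpace Ω] {P : Measure Ω} [IsProbabilityMeasure P]
    {Z : ℕ → Ω → 𝒵} (hZ : ∀ i, HasLaw (Z i) μ P) (hindep : iIndepFun Z P)
    {W : Submodule ℝ (Vec d)} {B : ℝ} {θ₀ : Vec d} (hθW : θ₀ ∈ W) (hθB : ‖θ₀‖ < B)
    {ℓ : 𝒵 → Vec d → ℝ} (hconv : ∀ z, ConvexOn ℝ Set.univ (ℓ z))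
    {ψ : 𝒵 → Vec d} (hψ : Measurable ψ) {C : ℝ} (hψC : ∀ z, ‖ψ z‖ ≤ C)
    {H : 𝒵 → Matrix (Fin d) (Fin d) ℝ} (hH : ∀ p q, Measurable fun z ↦ H z p q)
    {C' : ℝ} (hHC : ∀ z p q, |H z p q| ≤ C') {D : ℝ} (hD : 0 ≤ D)
    (htaylor : ∀ z h, |ℓ z (θ₀ + h) - ℓ z θ₀ -
      (inner ℝ (ψ z) h + h.ofLp ⬝ᵥ (H z *ᵥ h.ofLp) / 2)| ≤ D * ‖h‖ ^ 3)
    (hmean : ∀ t : Vec d, ∫ z, inner ℝ t (ψ z) ∂μ = 0)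
    (hV : (expMatrix μ H).IsSymm) (hpos : PosOn W (expMatrix μ H))
    {J : Matrix (Fin d) (Fin d) ℝ} (hJ : J.IsSymm)
    (hcov : ∀ t : Vec d, t.ofLp ⬝ᵥ (J *ᵥ t.ofLp) = ∫ z, (inner ℝ t (ψ z)) ^ 2 ∂μ)
    {θ : ℕ → Ω → Vec d} (hθm : ∀ n, AEMeasurable (θ n) P)
    (hθ : ∀ n, ∀ᵐ ω ∂P, θ n ω ∈ paramSet W B ∧
      IsMinOn (fun v ↦ ∑ i ∈ Finset.range n, ℓ (Z i ω) v) (paramSet W B) (θ n ω)) :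
    TendstoInDistribution (fun (n : ℕ) ω ↦ Real.sqrt n • (θ n ω - θ₀)) atTop id (fun _ ↦ P)
      (multivariateGaussian 0 (invOn W (expMatrix μ H) * J * invOn W (expMatrix μ H))) := by
  set V := expMatrix μ H with hVdef
  set N := invOn W V with hN
  have hNs : N.IsSymm := isSymm_invOn W hV
  set T := Matrix.toEuclideanCLM (𝕜 := ℝ) N with hT
  -- The influence function: its normalized sum is the linearization `α`, and its covariance is `N *
  -- J * N`.
  set a : 𝒵 → Vec d := fun z ↦ -T (ψ z) with ha
  have ham : Measurable a := (T.continuous.measurable.comp hψ).neg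
  have haC : ∀ z, ‖a z‖ ≤ ‖T‖ * C := fun z ↦ by
    rw [ha, norm_neg]
    exact (T.le_opNorm _).trans (by gcongr; exact hψC z)
  have hin : ∀ t z, inner ℝ t (a z) = -inner ℝ (T t) (ψ z) := fun t z ↦ by
    rw [ha, inner_neg_right, hT, inner_toEuclideanCLM_of_isSymm hNs]
  have hamean : ∀ t : Vec d, ∫ z, inner ℝ t (a z) ∂μ = 0 := fun t ↦ by
    simp_rw [hin]
    rw [integral_neg, hmean, neg_zero]
  have hquad : ∀ M (v : Vec d), v.ofLp ⬝ᵥ (M *ᵥ v.ofLp) =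
      inner ℝ v (Matrix.toEuclideanCLM (𝕜 := ℝ) M v) := fun M v ↦ by
    simp [Matrix.inner_toEuclideanCLM]
  have hacov : ∀ t : Vec d,
      t.ofLp ⬝ᵥ ((N * J * N) *ᵥ t.ofLp) = ∫ z, (inner ℝ t (a z)) ^ 2 ∂μ := fun t ↦ by
    simp_rw [hin, neg_sq]
    rw [← hcov, hquad, hquad, map_mul, map_mul, mul_apply_eq_comp, mul_apply_eq_comp,
      inner_toEuclideanCLM_of_isSymm hNs]
  have hPS : (N * J * N).PosSemidef := by
    refine Matrix.PosSemidef.of_dotProduct_mulVec_nonneg ?_ fun x ↦ ?_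
    · rw [Matrix.IsHermitian, Matrix.conjTranspose_eq_transpose_of_trivial]
      exact (isSymm_invOn_mul_mul_invOn W hV hJ).eq
    · have := hacov (WithLp.toLp 2 x)
      simp only [star_trivial] at this ⊢
      rw [this]
      exact integral_nonneg fun z ↦ sq_nonneg _
  have hclt := tendstoInDistribution_inv_sqrt_smul_sum hZ hindep ham haC hamean hPS hacov
  set α : ℕ → Ω → Vec d := fun n ω ↦ (Real.sqrt n)⁻¹ • ∑ i ∈ Finset.range n, a (Z i ω) with hα
  -- Slutsky: it remains to show that the rescaled estimator and `α` differ by a term tending to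
  -- zero in probability.
  refine tendstoInDistribution_of_tendstoInMeasure_sub _ _ hclt ?_
    (fun n ↦ ((hθm n).sub_const _).const_smul (Real.sqrt n))
  -- tightness of the linearization
  have htight : ∀ η : ENNReal, 0 < η → ∃ R : ℝ, 0 ≤ R ∧ ∀ n, P {ω | R < ‖α n ω‖} ≤ η := by
    have h1 := ProbabilityMeasure.tendsto_iff_tendsto_charFun.1 hclt.tendsto
    have h2 : IsTightMeasureSet (Set.range fun n ↦ P.map (α n)) := by
      have : ∀ n, IsProbabilityMeasure (P.map (α n)) := fun n ↦
        Measure.isProbabilityMeasure_map (hclt.forall_aemeasurable n)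
      -- Lévy: pointwise convergence of characteristic functions to a limit continuous at `0`
      -- already gives tightness, with one radius `R` for all `n`.
      refine isTightMeasureSet_of_tendsto_charFun ?_ h1
      simp only [ProbabilityMeasure.coe_mk, Measure.map_id]
      exact (continuous_charFun).continuousAt
    have h3 := tendsto_measure_norm_gt_of_isTightMeasureSet h2
    intro η hη
    obtain ⟨R, hR, hR0⟩ := ((h3.eventually_le_const hη).and (eventually_ge_atTop 0)).exists
    refine ⟨R, hR0, fun n ↦ ?_⟩
    have h4 : (P.map (α n)) {x | R < ‖x‖} ≤ η :=
      (le_iSup₂_of_le (f := fun (ν : Measure (Vec d)) (_ : ν ∈ Set.range fun n ↦ P.map (α n)) ↦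
        ν {x | R < ‖x‖}) _ ⟨n, rfl⟩ le_rfl).trans hR
    rwa [Measure.map_apply_of_aemeasurable (hclt.forall_aemeasurable n)
      (measurableSet_lt measurable_const measurable_norm)] at h4
  -- law of large numbers for the Hessian
  set Δ : ℕ → Ω → ℝ := fun n ω ↦
    ∑ p, ∑ q, |(∑ i ∈ Finset.range n, H (Z i ω) p q) / n - V p q| with hΔ
  have hΔm : TendstoInMeasure P Δ atTop 0 := by
    have hHZ : ∀ i p q, AEMeasurable (fun ω ↦ H (Z i ω) p q) P := fun i p q ↦
      (hH p q).comp_aemeasurable (hZ i).aemeasurable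
    refine tendstoInMeasure_of_tendsto_ae (fun n ↦ ?_) ?_
    · refine AEMeasurable.aestronglyMeasurable (Finset.aemeasurable_fun_sum _ fun p _ ↦
        Finset.aemeasurable_fun_sum _ fun q _ ↦ ?_)
      exact (((Finset.aemeasurable_fun_sum _ fun i _ ↦ hHZ i p q).div_const _).sub_const _).abs
    · have hpq : ∀ p q, ∀ᵐ ω ∂P, Tendsto
          (fun n : ℕ ↦ (∑ i ∈ Finset.range n, H (Z i ω) p q) / n) atTop (nhds (V p q)) := by
        intro p q
        have hE : P[fun ω ↦ H (Z 0 ω) p q] = V p q :=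
          (hZ 0).integral_comp (hH p q).aestronglyMeasurable
        rw [← hE]
        refine strong_law_ae_real (fun i ω ↦ H (Z i ω) p q) ?_ ?_ fun i ↦ ?_
        · exact Integrable.of_bound (hHZ 0 p q).aestronglyMeasurable C'
            (.of_forall fun ω ↦ hHC _ _ _)
        · intro i j hij
          exact (hindep.comp (fun _ z ↦ H z p q) fun _ ↦ hH p q).indepFun hij
        · have : IdentDistrib (Z i) (Z 0) P P :=
            ⟨(hZ i).aemeasurable, (hZ 0).aemeasurable, by rw [(hZ i).map_eq, (hZ 0).map_eq]⟩
          exact this.comp (hH p q)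
      filter_upwards [ae_all_iff.2 fun p ↦ ae_all_iff.2 fun q ↦ hpq p q] with ω hω
      have : Tendsto (fun n ↦ Δ n ω) atTop (nhds (∑ p : Fin d, ∑ q : Fin d, |V p q - V p q|)) :=
        tendsto_finsetSum _ fun p _ ↦ tendsto_finsetSum _ fun q _ ↦
          ((hω p q).sub_const _).abs
      simpa using this
  obtain ⟨c, hc0, hc⟩ := hpos.exists_pos_le
  rw [tendstoInMeasure_iff_norm] at hΔm ⊢
  intro ε hε
  rw [ENNReal.tendsto_nhds_zero]
  intro η hη
  obtain ⟨R, hR0, hR⟩ := htight (η / 2) (ENNReal.half_pos hη.ne')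
  -- The comparison needs `2δ < (c / 2) ε²`, and here `2δ = c ε² / 4`. Half of `δ` is spent on the
  -- cubic remainder, half on the Hessian error, whence the threshold `δ / (R + ε)²` below.
  set δ := c * ε ^ 2 / 8 with hδ
  have hδ0 : 0 < δ := by positivity
  have hRε : 0 < R + ε := by positivity
  have hsq : Tendsto (fun n : ℕ ↦ Real.sqrt n) atTop atTop :=
    Real.tendsto_sqrt_atTop.comp tendsto_natCast_atTop_atTop
  have hB : ∀ᶠ n : ℕ in atTop, ‖θ₀‖ + R / Real.sqrt n ≤ B := by
    have : Tendsto (fun n : ℕ ↦ ‖θ₀‖ + R / Real.sqrt n) atTop (nhds (‖θ₀‖ + 0)) :=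
      (hsq.const_div_atTop R).const_add _
    rw [add_zero] at this
    exact this.eventually_le_const hθB
  have hrem : ∀ᶠ n : ℕ in atTop, D * (R + ε) ^ 3 / Real.sqrt n ≤ δ / 2 :=
    (hsq.const_div_atTop _).eventually_le_const (by positivity)
  have hΔη := (ENNReal.tendsto_nhds_zero.1 (hΔm (δ / (R + ε) ^ 2) (by positivity))) (η / 2)
    (ENNReal.half_pos hη.ne')
  filter_upwards [hB, hrem, hΔη, eventually_gt_atTop 0] with n hnB hnrem hnΔ hn
  calc P {ω | ε ≤ ‖((fun (n : ℕ) ω ↦ Real.sqrt n • (θ n ω - θ₀)) - α) n ω - (0 : Ω → Vec d) ω‖}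
      ≤ P ({ω | R < ‖α n ω‖} ∪ {ω | δ / (R + ε) ^ 2 ≤ ‖Δ n ω - (0 : Ω → ℝ) ω‖}) := by
        refine measure_mono_ae ?_
        filter_upwards [hθ n] with ω hω
        intro hmem
        by_contra hcon
        have h1 : ¬ (R < ‖α n ω‖ ∨ δ / (R + ε) ^ 2 ≤ ‖Δ n ω - (0 : Ω → ℝ) ω‖) := hcon
        push Not at h1
        obtain ⟨h1, h2⟩ := h1
        have hmem' : ε ≤ ‖((fun (n : ℕ) ω ↦ Real.sqrt n • (θ n ω - θ₀)) - α) n ω -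
          (0 : Ω → Vec d) ω‖ := hmem
        simp only [Pi.sub_apply, Pi.zero_apply, sub_zero] at h2 hmem'
        have h3 : Δ n ω < δ / (R + ε) ^ 2 := (Real.le_norm_self _).trans_lt h2
        rw [lt_div_iff₀ (by positivity)] at h3
        refine absurd hmem' (not_le.2 ?_)
        exact norm_sqrt_smul_sub_sub_lt (δ := δ) hθW hconv hD htaylor hV hpos hc hn
          (fun i ↦ Z i ω) hω.1 hω.2 rfl hε h1 hnB (by simp only [hΔ] at h3; linarith)
          (by rw [hδ]; nlinarith [mul_pos hc0 (pow_pos hε 2)])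
    _ ≤ P {ω | R < ‖α n ω‖} + P {ω | δ / (R + ε) ^ 2 ≤ ‖Δ n ω - (0 : Ω → ℝ) ω‖} :=
        measure_union_le _ _
    _ ≤ η / 2 + η / 2 := add_le_add (hR n) hnΔ
    _ = η := ENNReal.add_halves η

end PlackettLuce

/-! ### Taylor expansion and convexity of log-sum-exp -/

/-- Crude third-order Taylor bound on `[0, 1]`. -/
theorem abs_sub_taylor_two_le {f f₁ f₂ f₃ : ℝ → ℝ} (h₀ : ∀ t, HasDerivAt f (f₁ t) t)
    (h₁ : ∀ t, HasDerivAt f₁ (f₂ t) t) (h₂ : ∀ t, HasDerivAt f₂ (f₃ t) t) {M : ℝ}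
    (hM : ∀ t, |f₃ t| ≤ M) : |f 1 - f 0 - (f₁ 0 + f₂ 0 / 2)| ≤ M := by
  have hM0 : 0 ≤ M := (abs_nonneg _).trans (hM 0)
  -- The mean value inequality is used three times: for `f₂`, for `f₁` minus its linear part, and
  -- for `f` minus its quadratic part. Bounding `t` by `1` each time gives `M` in place of `M / 6`.
  have key : ∀ {g g' : ℝ → ℝ}, (∀ t, HasDerivAt g (g' t) t) →
      (∀ t ∈ Set.Icc (0 : ℝ) 1, |g' t| ≤ M) → ∀ t ∈ Set.Icc (0 : ℝ) 1, |g t - g 0| ≤ M := by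
    intro g g' hg hb t ht
    have := Convex.norm_image_sub_le_of_norm_hasDerivWithin_le (f := g) (f' := g') (C := M)
      (fun x _ ↦ (hg x).hasDerivWithinAt) hb (convex_Icc (0 : ℝ) 1)
      (Set.left_mem_Icc.2 zero_le_one) ht
    rw [Real.norm_eq_abs, sub_zero, Real.norm_of_nonneg ht.1] at this
    exact this.trans (mul_le_of_le_one_right hM0 ht.2)
  have e₂ := key h₂ fun t _ ↦ hM t
  have e₁ := key (g := fun t ↦ f₁ t - f₂ 0 * t) (g' := fun t ↦ f₂ t - f₂ 0)
    (fun t ↦ by simpa using (h₁ t).fun_sub ((hasDerivAt_id t).const_mul (f₂ 0))) e₂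
  have e₀ := key (g := fun t ↦ f t - f₁ 0 * t - f₂ 0 * (t ^ 2 / 2))
    (g' := fun t ↦ f₁ t - f₁ 0 - f₂ 0 * t)
    (fun t ↦ by
      have := ((h₀ t).fun_sub ((hasDerivAt_id t).const_mul (f₁ 0))).fun_sub
        (((hasDerivAt_pow 2 t).div_const 2).const_mul (f₂ 0))
      simpa using this)
    (fun t ht ↦ by
      have := e₁ t ht
      simp only [mul_zero, sub_zero] at this
      convert this using 2
      ring) 1 (by simp)
  convert e₀ using 2
  ring

namespace PlackettLuce

section LogSumExp

variable {ι : Type*}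

/-- Logarithm of a sum of exponentials over a finite set. -/
noncomputable def logSumExp (s : Finset ι) (a : ι → ℝ) : ℝ := Real.log (∑ k ∈ s, Real.exp (a k))

/-- The sum of `b k ^ m` over a finite set, with weights `exp (a k + t * b k)`. -/
noncomputable def expMoment (s : Finset ι) (a b : ι → ℝ) (m : ℕ) (t : ℝ) : ℝ :=
  ∑ k ∈ s, b k ^ m * Real.exp (a k + t * b k)

theorem sum_exp_pos {s : Finset ι} (hs : s.Nonempty) (a : ι → ℝ) :
    0 < ∑ k ∈ s, Real.exp (a k) :=
  Finset.sum_pos (fun _ _ ↦ Real.exp_pos _) hs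

theorem expMoment_zero_pos {s : Finset ι} (hs : s.Nonempty) (a b : ι → ℝ) (t : ℝ) :
    0 < expMoment s a b 0 t := by
  simpa [expMoment] using sum_exp_pos hs fun k ↦ a k + t * b k

theorem logSumExp_add_mul (s : Finset ι) (a b : ι → ℝ) (t : ℝ) :
    logSumExp s (fun k ↦ a k + t * b k) = Real.log (expMoment s a b 0 t) := by
  simp [logSumExp, expMoment]

/-- Each derivative brings down one factor `b k`, so all derivatives of log-sum-exp are polynomials
in ratios of these moments. -/
theorem hasDerivAt_expMoment (s : Finset ι) (a b : ι → ℝ) (m : ℕ) (t : ℝ) :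
    HasDerivAt (expMoment s a b m) (expMoment s a b (m + 1) t) t := by
  unfold expMoment
  refine HasDerivAt.fun_sum fun k _ ↦ ?_
  have h := (((hasDerivAt_id t).mul_const (b k)).const_add (a k)).exp.const_mul (b k ^ m)
  simp only [id, one_mul] at h
  convert! h using 1
  ring

/-- The ratio is a weighted average of `b k ^ m`. The bound depends neither on `a` nor on `t`, which
makes the Taylor remainder uniform. -/
theorem abs_expMoment_div_le {s : Finset ι} (hs : s.Nonempty) (a : ι → ℝ) {b : ι → ℝ} {β : ℝ}
    (hb : ∀ k, |b k| ≤ β) (m : ℕ) (t : ℝ) :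
    |expMoment s a b m t / expMoment s a b 0 t| ≤ β ^ m := by
  have h0 := expMoment_zero_pos hs a b t
  rw [abs_div, abs_of_pos h0, div_le_iff₀ h0]
  unfold expMoment
  refine (Finset.abs_sum_le_sum_abs _ _).trans ?_
  rw [Finset.mul_sum]
  refine Finset.sum_le_sum fun k _ ↦ ?_
  rw [abs_mul, abs_pow, Real.abs_exp, pow_zero, one_mul]
  gcongr
  exact hb k

/-- Mean of `b` under the tilted weights. -/
noncomputable def tiltedMean (s : Finset ι) (a b : ι → ℝ) (t : ℝ) : ℝ :=
  expMoment s a b 1 t / expMoment s a b 0 t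

/-- Variance of `b` under the tilted weights. -/
noncomputable def tiltedVar (s : Finset ι) (a b : ι → ℝ) (t : ℝ) : ℝ :=
  expMoment s a b 2 t / expMoment s a b 0 t - (expMoment s a b 1 t / expMoment s a b 0 t) ^ 2

theorem hasDerivAt_logSumExp {s : Finset ι} (hs : s.Nonempty) (a b : ι → ℝ) (t : ℝ) :
    HasDerivAt (fun t ↦ logSumExp s fun k ↦ a k + t * b k) (tiltedMean s a b t) t := by
  simp only [logSumExp_add_mul]
  exact (hasDerivAt_expMoment s a b 0 t).log (expMoment_zero_pos hs a b t).ne'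

theorem hasDerivAt_tiltedMean {s : Finset ι} (hs : s.Nonempty) (a b : ι → ℝ) (t : ℝ) :
    HasDerivAt (tiltedMean s a b) (tiltedVar s a b t) t := by
  have h0 := (expMoment_zero_pos hs a b t).ne'
  convert! (hasDerivAt_expMoment s a b 1 t).div (hasDerivAt_expMoment s a b 0 t) h0 using 1
  simp only [tiltedVar, zero_add, one_add_one_eq_two]
  field_simp

theorem abs_logSumExp_taylor_le {s : Finset ι} (hs : s.Nonempty) (a : ι → ℝ) {b : ι → ℝ} {β : ℝ}
    (hb : ∀ k, |b k| ≤ β) :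
    |logSumExp s (fun k ↦ a k + b k) - logSumExp s a -
      (tiltedMean s a b 0 + tiltedVar s a b 0 / 2)| ≤ 6 * β ^ 3 := by
  set N := expMoment s a b with hN
  -- This is the third cumulant; its three terms are bounded by `β³`, `3β³` and `2β³`, which add up
  -- to the constant `6`.
  have hd2 : ∀ t, HasDerivAt (tiltedVar s a b) (N 3 t / N 0 t -
      3 * (N 1 t / N 0 t) * (N 2 t / N 0 t) + 2 * (N 1 t / N 0 t) ^ 3) t := fun t ↦ by
    have h0 := (expMoment_zero_pos hs a b t).ne'
    have h1 := (hasDerivAt_expMoment s a b 2 t).div (hasDerivAt_expMoment s a b 0 t) h0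
    convert! h1.sub ((hasDerivAt_tiltedMean hs a b t).pow 2) using 1
    simp only [tiltedVar, tiltedMean, hN, zero_add, show (2 : ℕ) - 1 = 1 from rfl, pow_one,
      Nat.cast_ofNat, Nat.reduceAdd]
    field_simp
    ring
  have h := abs_sub_taylor_two_le (hasDerivAt_logSumExp hs a b) (hasDerivAt_tiltedMean hs a b)
    hd2 (M := 6 * β ^ 3) fun t ↦ ?_
  · simpa using h
  · have b1 := abs_expMoment_div_le hs a hb 1 t
    have b2 := abs_expMoment_div_le hs a hb 2 t
    have b3 := abs_expMoment_div_le hs a hb 3 t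
    rw [← hN] at b1 b2 b3
    have hβ : 0 ≤ β := (abs_nonneg _).trans (hb hs.choose)
    rw [pow_one] at b1
    have c1 : |3 * (N 1 t / N 0 t) * (N 2 t / N 0 t)| ≤ 3 * β * β ^ 2 := by
      rw [abs_mul, abs_mul, abs_of_pos (by norm_num : (0 : ℝ) < 3)]
      gcongr
    have c2 : |2 * (N 1 t / N 0 t) ^ 3| ≤ 2 * β ^ 3 := by
      rw [abs_mul, abs_pow, abs_two]
      gcongr
    calc _ ≤ |N 3 t / N 0 t - 3 * (N 1 t / N 0 t) * (N 2 t / N 0 t)| +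
          |2 * (N 1 t / N 0 t) ^ 3| := abs_add_le _ _
      _ ≤ |N 3 t / N 0 t| + |3 * (N 1 t / N 0 t) * (N 2 t / N 0 t)| +
          |2 * (N 1 t / N 0 t) ^ 3| := by gcongr; exact abs_sub _ _
      _ ≤ β ^ 3 + 3 * β * β ^ 2 + 2 * β ^ 3 := by gcongr
      _ = 6 * β ^ 3 := by ring

/-- After subtracting its log-sum-exp each family becomes the logarithm of a probability vector, and
the claim reduces to convexity of `exp` term by term. -/
theorem logSumExp_convex_comb_le {s : Finset ι} (hs : s.Nonempty) (a b : ι → ℝ) {p q : ℝ}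
    (hp : 0 ≤ p) (hq : 0 ≤ q) (hpq : p + q = 1) :
    logSumExp s (fun k ↦ p * a k + q * b k) ≤ p * logSumExp s a + q * logSumExp s b := by
  have hexp : ∀ c : ι → ℝ, Real.exp (logSumExp s c) = ∑ k ∈ s, Real.exp (c k) := fun c ↦
    Real.exp_log (sum_exp_pos hs c)
  rw [← Real.exp_le_exp, hexp]
  have h : ∑ k ∈ s, Real.exp (p * (a k - logSumExp s a) + q * (b k - logSumExp s b)) ≤ 1 := by
    calc _ ≤ ∑ k ∈ s, (p * Real.exp (a k - logSumExp s a) +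
          q * Real.exp (b k - logSumExp s b)) := Finset.sum_le_sum fun k _ ↦ by
            simpa using convexOn_exp.2 (Set.mem_univ (a k - logSumExp s a))
              (Set.mem_univ (b k - logSumExp s b)) hp hq hpq
      _ = 1 := by
        rw [Finset.sum_add_distrib, ← Finset.mul_sum, ← Finset.mul_sum]
        simp only [Real.exp_sub, hexp, ← Finset.sum_div]
        rw [div_self (sum_exp_pos hs a).ne', div_self (sum_exp_pos hs b).ne', mul_one, mul_one, hpq]
  calc ∑ k ∈ s, Real.exp (p * a k + q * b k)
      = (∑ k ∈ s, Real.exp (p * (a k - logSumExp s a) + q * (b k - logSumExp s b))) *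
        Real.exp (p * logSumExp s a + q * logSumExp s b) := by
        rw [Finset.sum_mul]
        refine Finset.sum_congr rfl fun k _ ↦ ?_
        rw [← Real.exp_add]
        congr 1
        ring
    _ ≤ 1 * Real.exp (p * logSumExp s a + q * logSumExp s b) := by gcongr
    _ = _ := one_mul _

/-- A variance is half the mean squared difference of two independent draws. This is the form in
which the Hessian appears in `infoK`. -/
theorem tiltedVar_zero_eq {s : Finset ι} (hs : s.Nonempty) (a b : ι → ℝ) :
    tiltedVar s a b 0 = ∑ k ∈ s, ∑ k' ∈ s,
      Real.exp (a k + a k') / (2 * (∑ l ∈ s, Real.exp (a l)) ^ 2) * (b k - b k') ^ 2 := by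
  have h0 := (sum_exp_pos hs a).ne'
  simp only [tiltedVar, expMoment, zero_mul, add_zero, pow_zero, one_mul, pow_one]
  set N := ∑ l ∈ s, Real.exp (a l) with hN
  have h : ∑ k ∈ s, ∑ k' ∈ s, Real.exp (a k + a k') * (b k - b k') ^ 2 =
      2 * ((∑ k ∈ s, b k ^ 2 * Real.exp (a k)) * N - (∑ k ∈ s, b k * Real.exp (a k)) ^ 2) := by
    have e : ∀ k k', Real.exp (a k + a k') * (b k - b k') ^ 2 =
        (b k ^ 2 * Real.exp (a k)) * Real.exp (a k') + Real.exp (a k) * (b k' ^ 2 * Real.exp (a k'))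
        - 2 * ((b k * Real.exp (a k)) * (b k' * Real.exp (a k'))) := fun k k' ↦ by
      rw [Real.exp_add]; ring
    simp only [e, Finset.sum_add_distrib, Finset.sum_sub_distrib, ← Finset.mul_sum,
      ← Finset.sum_mul]
    rw [← hN]
    ring
  have h' : ∑ k ∈ s, ∑ k' ∈ s, Real.exp (a k + a k') / (2 * N ^ 2) * (b k - b k') ^ 2 =
      (∑ k ∈ s, ∑ k' ∈ s, Real.exp (a k + a k') * (b k - b k') ^ 2) / (2 * N ^ 2) := by
    simp only [Finset.sum_div]
    refine Finset.sum_congr rfl fun k _ ↦ Finset.sum_congr rfl fun k' _ ↦ by ring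
  rw [h', h]
  field_simp

/-- The weights sum to one, so the mean may be recentered at any `c`; `inner_blockScore` takes the
value at the winner. -/
theorem tiltedMean_zero_sub {s : Finset ι} (hs : s.Nonempty) (a b : ι → ℝ) (c : ℝ) :
    tiltedMean s a b 0 - c =
      ∑ k ∈ s, Real.exp (a k) / (∑ l ∈ s, Real.exp (a l)) * (b k - c) := by
  have h0 := (sum_exp_pos hs a).ne'
  simp only [tiltedMean, expMoment, zero_mul, add_zero, pow_zero, one_mul, pow_one, mul_sub,
    Finset.sum_sub_distrib, ← Finset.sum_mul, ← Finset.sum_div, div_self h0, sub_left_inj]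
  rw [Finset.sum_div]
  exact Finset.sum_congr rfl fun k _ ↦ by ring

end LogSumExp

/-! ### The loss of a single choice -/

section Block

variable {d : ℕ} {ι : Type*}

/-- Negative log-probability that `w` is chosen from `s`, with features `x` and parameter `θ`. -/
noncomputable def blockLoss (s : Finset ι) (w : ι) (x : ι → Vec d) (θ : Vec d) : ℝ :=
  logSumExp s (fun k ↦ inner ℝ θ (x k)) - inner ℝ θ (x w)

/-- Gradient of `blockLoss`. -/
noncomputable def blockScore (s : Finset ι) (w : ι) (x : ι → Vec d) (θ : Vec d) : Vec d :=
  ∑ k ∈ s, (Real.exp (inner ℝ θ (x k)) / ∑ l ∈ s, Real.exp (inner ℝ θ (x l))) • (x k - x w)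

/-- Hessian of `blockLoss`. -/
noncomputable def blockInfo (s : Finset ι) (x : ι → Vec d) (θ : Vec d) : Matrix (Fin d) (Fin d) ℝ :=
  ∑ k ∈ s, ∑ k' ∈ s, (Real.exp (inner ℝ θ (x k + x k')) /
    (2 * (∑ l ∈ s, Real.exp (inner ℝ θ (x l))) ^ 2)) • outer (x k - x k')

theorem dotProduct_outer_mulVec (x v : Vec d) :
    v.ofLp ⬝ᵥ (outer x *ᵥ v.ofLp) = (inner ℝ v x) ^ 2 := by
  rw [outer, Matrix.vecMulVec_mulVec, EuclideanSpace.inner_eq_star_dotProduct]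
  simp only [star_trivial, dotProduct_smul, MulOpposite.smul_eq_mul_unop, MulOpposite.unop_op]
  rw [dotProduct_comm v.ofLp]
  ring

theorem isSymm_outer (x : Vec d) : (outer x).IsSymm := by
  simp [Matrix.IsSymm, outer, Matrix.transpose_vecMulVec]

theorem neg_log_exp_div {x y : ℝ} (hy : 0 < y) :
    -Real.log (Real.exp x / y) = Real.log y - x := by
  rw [Real.log_div (Real.exp_ne_zero _) hy.ne', Real.log_exp]
  ring

theorem inner_blockScore {s : Finset ι} (hs : s.Nonempty) (w : ι) (x : ι → Vec d) (θ v : Vec d) :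
    inner ℝ v (blockScore s w x θ) =
      tiltedMean s (fun k ↦ inner ℝ θ (x k)) (fun k ↦ inner ℝ v (x k)) 0 - inner ℝ v (x w) := by
  rw [tiltedMean_zero_sub hs, blockScore, inner_sum]
  simp only [inner_smul_right, inner_sub_right]

theorem dotProduct_blockInfo_mulVec {s : Finset ι} (hs : s.Nonempty) (x : ι → Vec d)
    (θ v : Vec d) : v.ofLp ⬝ᵥ (blockInfo s x θ *ᵥ v.ofLp) =
      tiltedVar s (fun k ↦ inner ℝ θ (x k)) (fun k ↦ inner ℝ v (x k)) 0 := by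
  rw [tiltedVar_zero_eq hs, blockInfo]
  simp only [Matrix.sum_mulVec, dotProduct_sum, Matrix.smul_mulVec, dotProduct_smul,
    dotProduct_outer_mulVec, inner_add_right, inner_sub_right, smul_eq_mul]

/-- Along `h` the loss is a log-sum-exp plus a linear term, with slopes `⟨h, x k⟩` bounded by `L
‖h‖`; the linear term has no remainder. -/
theorem abs_blockLoss_taylor_le {s : Finset ι} (hs : s.Nonempty) (w : ι) {x : ι → Vec d} {L : ℝ}
    (hL : ∀ k, ‖x k‖ ≤ L) (θ h : Vec d) :
    |blockLoss s w x (θ + h) - blockLoss s w x θ -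
      (inner ℝ (blockScore s w x θ) h + h.ofLp ⬝ᵥ (blockInfo s x θ *ᵥ h.ofLp) / 2)| ≤
      6 * L ^ 3 * ‖h‖ ^ 3 := by
  have := abs_logSumExp_taylor_le hs (fun k ↦ inner ℝ θ (x k)) (b := fun k ↦ inner ℝ h (x k))
    (β := L * ‖h‖) fun k ↦ (abs_real_inner_le_norm _ _).trans (by
      rw [mul_comm]; gcongr; exact hL k)
  rw [real_inner_comm, inner_blockScore hs, dotProduct_blockInfo_mulVec hs, blockLoss, blockLoss]
  simp only [inner_add_left]
  convert this using 1
  · congr 1; ring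
  · ring

theorem convexOn_blockLoss {s : Finset ι} (hs : s.Nonempty) (w : ι) (x : ι → Vec d) :
    ConvexOn ℝ Set.univ (blockLoss s w x) := by
  refine ⟨convex_univ, fun θ _ η _ p q hp hq hpq ↦ ?_⟩
  have := logSumExp_convex_comb_le hs (fun k ↦ inner ℝ θ (x k)) (fun k ↦ inner ℝ η (x k)) hp hq hpq
  simp only [blockLoss, inner_add_left, real_inner_smul_left, smul_eq_mul]
  linarith

end Block

/-! ### Recursion of the Plackett-Luce model on the first choice -/

/-- Plackett-Luce probability of the ranking `σ` for items with weights `w`. -/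
noncomputable def plWeight {K : ℕ} (w : Fin K → ℝ) (σ : Equiv.Perm (Fin K)) : ℝ :=
  ∏ i, w (σ i) / ∑ j ∈ Finset.Ici i, w (σ j)

theorem sum_Ici_succ {K : ℕ} (f : Fin (K + 1) → ℝ) (i : Fin K) :
    ∑ j ∈ Finset.Ici i.succ, f j = ∑ j ∈ Finset.Ici i, f j.succ := by
  rw [← Fin.map_succEmb_Ici, Finset.sum_map]
  rfl

theorem sum_Ioi_succ {K : ℕ} (f : Fin (K + 1) → ℝ) (i : Fin K) :
    ∑ j ∈ Finset.Ioi i.succ, f j = ∑ j ∈ Finset.Ioi i, f j.succ := by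
  rw [← Fin.map_succEmb_Ioi, Finset.sum_map]
  rfl

/-- Sequential choice: `p` comes first with probability proportional to its weight, and the rest is
a Plackett-Luce ranking of the other items, which `swap 0 p` relabels by `Fin K`. This recursion
drives both inductions below. -/
theorem plWeight_decomposeFin {K : ℕ} (w : Fin (K + 1) → ℝ) (p : Fin (K + 1))
    (e : Equiv.Perm (Fin K)) :
    plWeight w (Equiv.Perm.decomposeFin.symm (p, e)) =
      w p / (∑ i, w i) * plWeight (fun i ↦ w (Equiv.swap 0 p i.succ)) e := by
  rw [plWeight, Fin.prod_univ_succ]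
  congr 1
  · rw [Equiv.Perm.decomposeFin_symm_apply_zero,
      show Finset.Ici (0 : Fin (K + 1)) = Finset.univ from Finset.Ici_bot]
    rw [Equiv.sum_comp (Equiv.Perm.decomposeFin.symm (p, e)) w]
  · refine Finset.prod_congr rfl fun i _ ↦ ?_
    rw [sum_Ici_succ]
    simp only [Equiv.Perm.decomposeFin_symm_apply_succ]

theorem sum_perm_succ {K : ℕ} (f : Equiv.Perm (Fin (K + 1)) → ℝ) :
    ∑ σ, f σ = ∑ p, ∑ e, f (Equiv.Perm.decomposeFin.symm (p, e)) := by
  rw [← Equiv.sum_comp Equiv.Perm.decomposeFin.symm f, Fintype.sum_prod_type]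

theorem sum_plWeight {K : ℕ} (w : Fin K → ℝ) (hw : ∀ i, 0 < w i) : ∑ σ, plWeight w σ = 1 := by
  induction K with
  | zero => simp [plWeight]
  | succ K ih =>
    rw [sum_perm_succ]
    simp only [plWeight_decomposeFin, ← Finset.mul_sum]
    have h : ∀ p : Fin (K + 1), ∑ e, plWeight (fun i ↦ w (Equiv.swap 0 p i.succ)) e = 1 :=
      fun p ↦ ih _ fun i ↦ hw _
    simp only [h, mul_one, ← Finset.sum_div]
    exact div_self (Finset.sum_pos (fun i _ ↦ hw i) Finset.univ_nonempty).ne'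

/-- The Plackett-Luce model ranks `a` before `b` with odds `w a : w b`, in the form of a vanishing
expectation. -/
theorem sum_plWeight_mul_pair {K : ℕ} (w : Fin K → ℝ) (hw : ∀ i, 0 < w i)
    (g : Fin K → Fin K → ℝ) (hg : ∀ a b, g a b = -g b a) :
    ∑ σ, plWeight w σ * ∑ j, ∑ k ∈ Finset.Ioi j, w (σ k) * g (σ j) (σ k) = 0 := by
  induction K with
  | zero => simp
  | succ K ih =>
    have hself : ∀ a, g a a = 0 := fun a ↦ by linarith [hg a a]
    -- The pairs headed by the top item `p` run over all other items whatever their order `e`;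
    -- adding `b = p` costs nothing since `g p p = 0`.
    have hfirst : ∀ (p : Fin (K + 1)) (e : Equiv.Perm (Fin K)),
        ∑ k : Fin K, w (Equiv.swap 0 p (e k).succ) * g p (Equiv.swap 0 p (e k).succ) =
          ∑ b, w b * g p b := fun p e ↦ by
      rw [Equiv.sum_comp e (fun k ↦ w (Equiv.swap 0 p k.succ) * g p (Equiv.swap 0 p k.succ)),
        ← Equiv.sum_comp (Equiv.swap 0 p) (fun b ↦ w b * g p b), Fin.sum_univ_succ]
      simp [hself]
    have hrec : ∀ (p : Fin (K + 1)) (e : Equiv.Perm (Fin K)),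
        ∑ j, ∑ k ∈ Finset.Ioi j, w (Equiv.Perm.decomposeFin.symm (p, e) k) *
          g (Equiv.Perm.decomposeFin.symm (p, e) j) (Equiv.Perm.decomposeFin.symm (p, e) k) =
        ∑ b, w b * g p b + ∑ j, ∑ k ∈ Finset.Ioi j, w (Equiv.swap 0 p (e k).succ) *
          g (Equiv.swap 0 p (e j).succ) (Equiv.swap 0 p (e k).succ) := fun p e ↦ by
      rw [Fin.sum_univ_succ, ← hfirst p e, Fin.sum_Ioi_zero]
      simp only [sum_Ioi_succ, Equiv.Perm.decomposeFin_symm_apply_succ,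
        Equiv.Perm.decomposeFin_symm_apply_zero]
    rw [sum_perm_succ]
    simp only [hrec, plWeight_decomposeFin, mul_assoc, mul_add, Finset.sum_add_distrib,
      ← Finset.mul_sum]
    have h1 : ∀ p : Fin (K + 1), ∑ e : Equiv.Perm (Fin K),
        plWeight (fun i ↦ w (Equiv.swap 0 p i.succ)) e *
          ∑ j, ∑ k ∈ Finset.Ioi j, w (Equiv.swap 0 p (e k).succ) *
            g (Equiv.swap 0 p (e j).succ) (Equiv.swap 0 p (e k).succ) = 0 := fun p ↦
      ih (fun i ↦ w (Equiv.swap 0 p i.succ)) (fun i ↦ hw _)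
        (fun i j ↦ g (Equiv.swap 0 p i.succ) (Equiv.swap 0 p j.succ)) fun i j ↦ hg _ _
    have h2 : ∀ p : Fin (K + 1), ∑ e : Equiv.Perm (Fin K),
        plWeight (fun i ↦ w (Equiv.swap 0 p i.succ)) e = 1 := fun p ↦ sum_plWeight _ fun i ↦ hw _
    -- The product `w p * w b` is symmetric and `g` antisymmetric, so exchanging the indices changes
    -- the sign of the sum.
    have h3 : ∑ p, ∑ b, w p * (w b * g p b) = 0 := by
      have : ∑ p, ∑ b, w p * (w b * g p b) = -∑ p, ∑ b, w p * (w b * g p b) := by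
        conv_lhs => rw [Finset.sum_comm]
        simp only [← Finset.sum_neg_distrib]
        refine Finset.sum_congr rfl fun p _ ↦ Finset.sum_congr rfl fun b _ ↦ ?_
        rw [hg b p]; ring
      linarith
    simp only [h1, mul_zero, Finset.sum_const_zero, add_zero, ← Finset.sum_mul, h2, one_mul]
    simp only [Finset.mul_sum] at h3 ⊢
    rw [← mul_zero (∑ i, w i)⁻¹, ← h3, Finset.mul_sum]
    refine Finset.sum_congr rfl fun p _ ↦ ?_
    rw [Finset.mul_sum]
    exact Finset.sum_congr rfl fun b _ ↦ by ring

/-! ### Score and information identities -/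

section Score

variable {K : ℕ}

/-- Probability of a ranking for items with log-weights `a`. -/
theorem plWeight_exp (a : Fin K → ℝ) (σ : Equiv.Perm (Fin K)) :
    plWeight (fun i ↦ Real.exp (a i)) σ =
      Real.exp (∑ j, (a (σ j) - logSumExp (Finset.Ici j) fun k ↦ a (σ k))) := by
  rw [Real.exp_sum, plWeight]
  refine Finset.prod_congr rfl fun j _ ↦ ?_
  rw [Real.exp_sub, logSumExp, Real.exp_log (sum_exp_pos Finset.nonempty_Ici _)]

/-- Directional score of the Plackett-Luce log-likelihood, along `b`. -/
noncomputable def plScore (a b : Fin K → ℝ) (σ : Equiv.Perm (Fin K)) (t : ℝ) : ℝ :=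
  ∑ j, (b (σ j) - tiltedMean (Finset.Ici j) (fun k ↦ a (σ k)) (fun k ↦ b (σ k)) t)

/-- Directional observed information of the Plackett-Luce log-likelihood, along `b`. -/
noncomputable def plInfo (a b : Fin K → ℝ) (σ : Equiv.Perm (Fin K)) (t : ℝ) : ℝ :=
  ∑ j, tiltedVar (Finset.Ici j) (fun k ↦ a (σ k)) (fun k ↦ b (σ k)) t

theorem hasDerivAt_plWeight (a b : Fin K → ℝ) (σ : Equiv.Perm (Fin K)) (t : ℝ) :
    HasDerivAt (fun t ↦ plWeight (fun i ↦ Real.exp (a i + t * b i)) σ)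
      (plWeight (fun i ↦ Real.exp (a i + t * b i)) σ * plScore a b σ t) t := by
  simp only [plWeight_exp]
  refine HasDerivAt.exp (HasDerivAt.fun_sum fun j _ ↦ ?_)
  refine HasDerivAt.fun_sub ?_ (hasDerivAt_logSumExp Finset.nonempty_Ici _ _ t)
  simpa using ((hasDerivAt_id t).mul_const (b (σ j))).const_add (a (σ j))

theorem hasDerivAt_plScore (a b : Fin K → ℝ) (σ : Equiv.Perm (Fin K)) (t : ℝ) :
    HasDerivAt (plScore a b σ) (-plInfo a b σ t) t := by
  unfold plScore plInfo
  rw [← Finset.sum_neg_distrib]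
  exact HasDerivAt.fun_sum fun j _ ↦
    (hasDerivAt_tiltedMean Finset.nonempty_Ici _ _ t).const_sub _

/-- Differentiate the constant total probability `1`; the derivative of a probability is the
probability times its score. -/
theorem sum_plWeight_mul_plScore (a b : Fin K → ℝ) (t : ℝ) :
    ∑ σ, plWeight (fun i ↦ Real.exp (a i + t * b i)) σ * plScore a b σ t = 0 := by
  have h := HasDerivAt.fun_sum (u := Finset.univ) fun σ _ ↦ hasDerivAt_plWeight a b σ t
  have h1 : (fun t ↦ ∑ σ, plWeight (fun i ↦ Real.exp (a i + t * b i)) σ) = fun _ ↦ 1 := by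
    ext t
    exact sum_plWeight _ fun i ↦ Real.exp_pos _
  rw [h1] at h
  exact h.unique (hasDerivAt_const t 1)

/-- The information identity for the Plackett-Luce model. -/
theorem sum_plWeight_mul_plScore_sq (a b : Fin K → ℝ) (t : ℝ) :
    ∑ σ, plWeight (fun i ↦ Real.exp (a i + t * b i)) σ * plScore a b σ t ^ 2 =
      ∑ σ, plWeight (fun i ↦ Real.exp (a i + t * b i)) σ * plInfo a b σ t := by
  -- Differentiate the identity for the mean score once more: the product rule produces the squared
  -- score minus the information.
  have h := HasDerivAt.fun_sum (u := Finset.univ) fun σ _ ↦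
    (hasDerivAt_plWeight a b σ t).fun_mul (hasDerivAt_plScore a b σ t)
  have h1 : (fun t ↦ ∑ σ, plWeight (fun i ↦ Real.exp (a i + t * b i)) σ * plScore a b σ t) =
      fun _ ↦ 0 := by
    ext t
    exact sum_plWeight_mul_plScore a b t
  rw [h1] at h
  have h2 := h.unique (hasDerivAt_const t 0)
  rw [← sub_eq_zero, ← Finset.sum_sub_distrib, ← h2]
  exact Finset.sum_congr rfl fun σ _ ↦ by ring

end Score

/-! ### The law of one observation and expected matrices -/

section Model

variable {S A : Type*} {d K : ℕ}

theorem plProb_eq_plWeight (φ : S → A → Vec d) (θ : Vec d) (s : S) (a : Fin K → A)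
    (σ : Equiv.Perm (Fin K)) :
    plProb φ θ s a σ = plWeight (fun i ↦ Real.exp (inner ℝ θ (φ s (a i)))) σ := rfl

theorem plProb_pos (φ : S → A → Vec d) (θ : Vec d) (s : S) (a : Fin K → A)
    (σ : Equiv.Perm (Fin K)) : 0 < plProb φ θ s a σ :=
  Finset.prod_pos fun _ _ ↦
    div_pos (Real.exp_pos _) (sum_exp_pos Finset.nonempty_Ici _)

/-- Continuous functions of the ranked features are bounded. -/
theorem exists_norm_le_of_continuous {φ : S → A → Vec d} {L : ℝ} (hL : ∀ s a, ‖φ s a‖ ≤ L)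
    {F : Type*} [NormedAddCommGroup F] {f : (Fin K → Vec d) → F} (hf : Continuous f) :
    ∃ C, ∀ z : Obs S A K, ‖f (rankedFeature φ z)‖ ≤ C := by
  obtain ⟨C, hC⟩ := (isCompact_univ_pi fun _ : Fin K ↦
    isCompact_closedBall (0 : Vec d) L).exists_bound_of_continuousOn hf.continuousOn
  exact ⟨C, fun z ↦ hC _ fun j _ ↦ mem_closedBall_zero_iff.2 (hL _ _)⟩

variable [MeasurableSpace S] [MeasurableSpace A]

theorem measurable_rankedFeature {φ : S → A → Vec d} (hφ : Measurable fun p : S × A ↦ φ p.1 p.2) :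
    Measurable fun z : Obs S A K ↦ rankedFeature φ z := by
  refine measurable_from_prod_countable_left fun σ ↦ measurable_pi_lambda _ fun j ↦ ?_
  exact hφ.comp (measurable_fst.prodMk ((measurable_pi_apply (σ j)).comp measurable_snd))

theorem measurable_plProb {φ : S → A → Vec d} (hφ : Measurable fun p : S × A ↦ φ p.1 p.2)
    (θ : Vec d) (σ : Equiv.Perm (Fin K)) :
    Measurable fun x : S × (Fin K → A) ↦ plProb φ θ x.1 x.2 σ := by
  have h : ∀ j : Fin K, Measurable fun x : S × (Fin K → A) ↦ φ x.1 (x.2 j) := fun j ↦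
    hφ.comp (measurable_fst.prodMk ((measurable_pi_apply j).comp measurable_snd))
  unfold plProb reward
  fun_prop

/-- A bounded measurable function whose conditional expectation given the state and the actions
vanishes has mean zero. -/
theorem integral_obsLaw_eq_zero {ρ : Measure S} [IsProbabilityMeasure ρ]
    {κ : Kernel S (Fin K → A)} [IsMarkovKernel κ] {φ : S → A → Vec d}
    (hφ : Measurable fun p : S × A ↦ φ p.1 p.2) {θ : Vec d}
    [IsFiniteMeasure (obsLaw ρ κ φ θ)] {f : Obs S A K → ℝ} (hf : Measurable f)
    {C : ℝ} (hC : ∀ z, ‖f z‖ ≤ C) (h0 : ∀ s a, ∑ σ, plProb φ θ s a σ * f ((s, a), σ) = 0) :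
    ∫ z, f z ∂(obsLaw ρ κ φ θ) = 0 := by
  have hint : Integrable f (obsLaw ρ κ φ θ) :=
    Integrable.of_bound hf.aestronglyMeasurable C (.of_forall hC)
  unfold obsLaw at hint ⊢
  rw [integrable_finsetSum_measure] at hint
  rw [integral_finsetSum_measure hint]
  have hmk : ∀ σ : Equiv.Perm (Fin K), Measurable fun x : S × (Fin K → A) ↦ (x, σ) := fun σ ↦
    measurable_id.prodMk measurable_const
  have hdm : ∀ σ : Equiv.Perm (Fin K),
      Measurable fun x : S × (Fin K → A) ↦ ENNReal.ofReal (plProb φ θ x.1 x.2 σ) := fun σ ↦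
    (measurable_plProb hφ θ σ).ennreal_ofReal
  have hsmul : ∀ σ : Equiv.Perm (Fin K), Integrable
      (fun x : S × (Fin K → A) ↦ plProb φ θ x.1 x.2 σ * f (x, σ)) (ρ ⊗ₘ κ) := fun σ ↦ by
    have h := hint σ (Finset.mem_univ _)
    rw [integrable_map_measure hf.aestronglyMeasurable (hmk σ).aemeasurable,
      integrable_withDensity_iff_integrable_smul' (hdm σ)
        (.of_forall fun _ ↦ ENNReal.ofReal_lt_top)] at h
    refine h.congr (.of_forall fun x ↦ ?_)
    simp [ENNReal.toReal_ofReal (plProb_pos φ θ x.1 x.2 σ).le]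
  have hterm : ∀ σ : Equiv.Perm (Fin K),
      ∫ z, f z ∂(((ρ ⊗ₘ κ).withDensity fun x ↦ ENNReal.ofReal (plProb φ θ x.1 x.2 σ)).map
        fun x ↦ (x, σ)) = ∫ x, plProb φ θ x.1 x.2 σ * f (x, σ) ∂(ρ ⊗ₘ κ) := fun σ ↦ by
    rw [integral_map (hmk σ).aemeasurable hf.aestronglyMeasurable,
      integral_withDensity_eq_integral_toReal_smul (hdm σ)
        (.of_forall fun _ ↦ ENNReal.ofReal_lt_top)]
    refine integral_congr_ae (.of_forall fun x ↦ ?_)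
    simp [ENNReal.toReal_ofReal (plProb_pos φ θ x.1 x.2 σ).le]
  simp only [hterm]
  rw [← integral_finsetSum _ fun σ _ ↦ hsmul σ]
  simp only [h0, integral_zero]

/-- Events of full probability under the law of one observation hold for every fixed ranking. -/
theorem ae_of_ae_obsLaw {ρ : Measure S} {κ : Kernel S (Fin K → A)} {φ : S → A → Vec d}
    (hφ : Measurable fun p : S × A ↦ φ p.1 p.2) {θ : Vec d} {p : Obs S A K → Prop}
    (hp : ∀ᵐ z ∂(obsLaw ρ κ φ θ), p z) (σ : Equiv.Perm (Fin K)) :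
    ∀ᵐ x ∂(ρ ⊗ₘ κ), p (x, σ) := by
  rw [obsLaw, ← Measure.sum_fintype, Measure.ae_sum_iff] at hp
  have h1 := ae_of_ae_map (measurable_id.prodMk measurable_const).aemeasurable (hp σ)
  rw [ae_withDensity_iff (measurable_plProb hφ θ σ).ennreal_ofReal] at h1
  filter_upwards [h1] with x hx
  -- The density of each ranking is strictly positive, so null sets are not lost in passing to the
  -- law of the state and actions.
  exact hx (by simpa using plProb_pos φ θ x.1 x.2 σ)

end Model

theorem isSymm_expMatrix {d : ℕ} {𝒵 : Type*} [MeasurableSpace 𝒵] {μ : Measure 𝒵}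
    {M : 𝒵 → Matrix (Fin d) (Fin d) ℝ} (hM : ∀ z, (M z).IsSymm) : (expMatrix μ M).IsSymm := by
  ext p q
  simp only [expMatrix, Matrix.transpose_apply, Matrix.of_apply, (hM _).apply]

theorem dotProduct_expMatrix_mulVec {d : ℕ} {𝒵 : Type*} [MeasurableSpace 𝒵] {μ : Measure 𝒵}
    {M : 𝒵 → Matrix (Fin d) (Fin d) ℝ} (hM : ∀ p q, Integrable (fun z ↦ M z p q) μ) (v : Vec d) :
    v.ofLp ⬝ᵥ (expMatrix μ M *ᵥ v.ofLp) = ∫ z, v.ofLp ⬝ᵥ (M z *ᵥ v.ofLp) ∂μ := by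
  simp only [dotProduct, Matrix.mulVec, expMatrix, Matrix.of_apply]
  rw [integral_finsetSum _ fun p _ ↦
    (integrable_finsetSum _ fun q _ ↦ (hM p q).mul_const _).const_mul _]
  refine Finset.sum_congr rfl fun p _ ↦ ?_
  rw [integral_const_mul, integral_finsetSum _ fun q _ ↦ (hM p q).mul_const _]
  simp only [integral_mul_const]

/-! ### Sums of choice losses -/

section Family

variable {d K : ℕ} {I : Type*}

/-- A sum of choice losses; the block `s c` is won by the item `w c`. -/
noncomputable def familyLoss (T : Finset I) (s : I → Finset (Fin K)) (w : I → Fin K)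
    (x : Fin K → Vec d) (θ : Vec d) : ℝ := ∑ c ∈ T, blockLoss (s c) (w c) x θ

/-- Gradient of `familyLoss`. -/
noncomputable def familyScore (T : Finset I) (s : I → Finset (Fin K)) (w : I → Fin K) (θ : Vec d)
    (x : Fin K → Vec d) : Vec d := ∑ c ∈ T, blockScore (s c) (w c) x θ

/-- Hessian of `familyLoss`. -/
noncomputable def familyInfo (T : Finset I) (s : I → Finset (Fin K)) (θ : Vec d)
    (x : Fin K → Vec d) : Matrix (Fin d) (Fin d) ℝ := ∑ c ∈ T, blockInfo (s c) x θ

variable {T : Finset I} {s : I → Finset (Fin K)}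

theorem continuous_familyScore (hs : ∀ c, (s c).Nonempty) (w : I → Fin K) (θ : Vec d) :
    Continuous (familyScore T s w θ) := by
  unfold familyScore blockScore
  have h : ∀ c (x : Fin K → Vec d), ∑ l ∈ s c, Real.exp (inner ℝ θ (x l)) ≠ 0 := fun c x ↦
    (sum_exp_pos (hs c) _).ne'
  refine continuous_finsetSum _ fun c _ ↦ continuous_finsetSum _ fun k _ ↦ ?_
  refine Continuous.smul (Continuous.div (by fun_prop) (by fun_prop) (h c)) (by fun_prop)

theorem continuous_familyInfo (hs : ∀ c, (s c).Nonempty) (θ : Vec d) (p q : Fin d) :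
    Continuous fun x ↦ familyInfo T s θ x p q := by
  unfold familyInfo blockInfo
  simp only [Matrix.sum_apply, Matrix.smul_apply, smul_eq_mul, outer, Matrix.vecMulVec_apply]
  have h : ∀ c (x : Fin K → Vec d), 2 * (∑ l ∈ s c, Real.exp (inner ℝ θ (x l))) ^ 2 ≠ 0 :=
    fun c x ↦ (mul_pos two_pos (pow_pos (sum_exp_pos (hs c) _) 2)).ne'
  refine continuous_finsetSum _ fun c _ ↦ continuous_finsetSum _ fun k _ ↦
    continuous_finsetSum _ fun k' _ ↦ ?_
  exact Continuous.mul (Continuous.div (by fun_prop) (by fun_prop) (h c)) (by fun_prop)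

theorem isSymm_familyInfo (θ : Vec d) (x : Fin K → Vec d) : (familyInfo T s θ x).IsSymm := by
  unfold familyInfo blockInfo Matrix.IsSymm
  simp only [Matrix.transpose_sum, Matrix.transpose_smul, (isSymm_outer _).eq]

theorem convexOn_familyLoss (hs : ∀ c, (s c).Nonempty) (w : I → Fin K) (x : Fin K → Vec d) :
    ConvexOn ℝ Set.univ (familyLoss T s w x) := by
  refine ⟨convex_univ, fun θ _ η _ p q hp hq hpq ↦ ?_⟩
  simp only [familyLoss, smul_eq_mul, Finset.mul_sum, ← Finset.sum_add_distrib]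
  exact Finset.sum_le_sum fun c _ ↦
    (convexOn_blockLoss (hs c) (w c) x).2 (Set.mem_univ θ) (Set.mem_univ η) hp hq hpq

theorem abs_familyLoss_taylor_le (hs : ∀ c, (s c).Nonempty) (w : I → Fin K) {x : Fin K → Vec d}
    {L : ℝ} (hL : ∀ k, ‖x k‖ ≤ L) (θ h : Vec d) :
    |familyLoss T s w x (θ + h) - familyLoss T s w x θ - (inner ℝ (familyScore T s w θ x) h +
      h.ofLp ⬝ᵥ (familyInfo T s θ x *ᵥ h.ofLp) / 2)| ≤ (T.card * (6 * L ^ 3)) * ‖h‖ ^ 3 := by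
  simp only [familyLoss, familyScore, familyInfo, sum_inner, Matrix.sum_mulVec, dotProduct_sum,
    Finset.sum_div, ← Finset.sum_add_distrib, ← Finset.sum_sub_distrib]
  refine (Finset.abs_sum_le_sum_abs _ _).trans ((Finset.sum_le_sum fun c _ ↦
    abs_blockLoss_taylor_le (hs c) (w c) hL θ h).trans_eq ?_)
  rw [Finset.sum_const, nsmul_eq_mul]
  ring

theorem dotProduct_blockInfo_eq_sum (s : Finset (Fin K)) (x : Fin K → Vec d) (θ v : Vec d) :
    v.ofLp ⬝ᵥ (blockInfo s x θ *ᵥ v.ofLp) = ∑ k ∈ s, ∑ k' ∈ s,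
      Real.exp (inner ℝ θ (x k + x k')) / (2 * (∑ l ∈ s, Real.exp (inner ℝ θ (x l))) ^ 2) *
        (inner ℝ v (x k - x k')) ^ 2 := by
  simp only [blockInfo, Matrix.sum_mulVec, dotProduct_sum, Matrix.smul_mulVec, dotProduct_smul,
    dotProduct_outer_mulVec, smul_eq_mul]

theorem dotProduct_blockInfo_nonneg (s : Finset (Fin K)) (x : Fin K → Vec d) (θ v : Vec d) :
    0 ≤ v.ofLp ⬝ᵥ (blockInfo s x θ *ᵥ v.ofLp) := by
  rw [dotProduct_blockInfo_eq_sum]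
  positivity

theorem dotProduct_familyInfo_nonneg (x : Fin K → Vec d) (θ v : Vec d) :
    0 ≤ v.ofLp ⬝ᵥ (familyInfo T s θ x *ᵥ v.ofLp) := by
  simp only [familyInfo, Matrix.sum_mulVec, dotProduct_sum]
  exact Finset.sum_nonneg fun c _ ↦ dotProduct_blockInfo_nonneg _ _ _ _

/-- The quadratic form is a sum of squares `⟨v, x k - x k'⟩²` with strictly positive weights, so
each square vanishes; a block containing both positions supplies the one needed. -/
theorem inner_sub_eq_zero_of_dotProduct_familyInfo (hs : ∀ c, (s c).Nonempty)
    (hconn : ∀ j k : Fin K, j ≠ k → ∃ c ∈ T, j ∈ s c ∧ k ∈ s c) {x : Fin K → Vec d} {θ v : Vec d}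
    (h : v.ofLp ⬝ᵥ (familyInfo T s θ x *ᵥ v.ofLp) = 0) (j k : Fin K) :
    inner ℝ v (x j - x k) = 0 := by
  rcases eq_or_ne j k with rfl | hjk
  · simp
  obtain ⟨c, hc, hj, hk⟩ := hconn j k hjk
  simp only [familyInfo, Matrix.sum_mulVec, dotProduct_sum] at h
  rw [Finset.sum_eq_zero_iff_of_nonneg fun c _ ↦ dotProduct_blockInfo_nonneg _ _ _ _] at h
  have h1 := h c hc
  rw [dotProduct_blockInfo_eq_sum, Finset.sum_eq_zero_iff_of_nonneg fun _ _ ↦ by positivity] at h1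
  have h2 := h1 j hj
  rw [Finset.sum_eq_zero_iff_of_nonneg fun _ _ ↦ by positivity] at h2
  have hpos := sum_exp_pos (hs c) fun l ↦ (inner ℝ θ (x l) : ℝ)
  simpa [hpos.ne', Real.exp_ne_zero] using h2 k hk

variable {S A : Type*} [MeasurableSpace S] [MeasurableSpace A]

theorem integrable_familyInfo {φ : S → A → Vec d} (hφ : Measurable fun p : S × A ↦ φ p.1 p.2)
    {L : ℝ} (hL : ∀ s a, ‖φ s a‖ ≤ L) {μ : Measure (Obs S A K)} [IsFiniteMeasure μ]
    (hs : ∀ c, (s c).Nonempty) (θ : Vec d) (p q : Fin d) :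
    Integrable (fun z ↦ familyInfo T s θ (rankedFeature φ z) p q) μ := by
  have hc := continuous_familyInfo (T := T) hs θ p q
  obtain ⟨C, hC⟩ := exists_norm_le_of_continuous (K := K) hL hc
  exact Integrable.of_bound
    (hc.measurable.comp (measurable_rankedFeature hφ)).aestronglyMeasurable C (.of_forall hC)

/-- Under identifiability the expected Hessian is positive definite on the subspace, as soon as
every pair of positions is compared in some block. -/
theorem posOn_expMatrix_familyInfo {ρ : Measure S} {κ : Kernel S (Fin K → A)}
    {φ : S → A → Vec d} (hφ : Measurable fun p : S × A ↦ φ p.1 p.2)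
    {L : ℝ} (hL : ∀ s a, ‖φ s a‖ ≤ L) {W : Submodule ℝ (Vec d)}
    (hident : ∀ v ∈ W,
      (∀ᵐ x ∂(ρ ⊗ₘ κ), ∀ j k : Fin K, inner ℝ v (φ x.1 (x.2 j) - φ x.1 (x.2 k)) = 0) → v = 0)
    {θ : Vec d} [IsFiniteMeasure (obsLaw ρ κ φ θ)] (hs : ∀ c, (s c).Nonempty)
    (hconn : ∀ j k : Fin K, j ≠ k → ∃ c ∈ T, j ∈ s c ∧ k ∈ s c) :
    PosOn W (expMatrix (obsLaw ρ κ φ θ) fun z ↦ familyInfo T s θ (rankedFeature φ z)) := by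
  intro v hv hv0
  rw [dotProduct_expMatrix_mulVec fun p q ↦ integrable_familyInfo hφ hL hs θ p q]
  have hnn : ∀ z : Obs S A K,
      0 ≤ v.ofLp ⬝ᵥ (familyInfo T s θ (rankedFeature φ z) *ᵥ v.ofLp) := fun z ↦
    dotProduct_familyInfo_nonneg _ _ _
  refine (integral_nonneg hnn).lt_of_ne' fun h0 ↦ hv0 (hident v hv ?_)
  have hint : Integrable
      (fun z : Obs S A K ↦ v.ofLp ⬝ᵥ (familyInfo T s θ (rankedFeature φ z) *ᵥ v.ofLp))
      (obsLaw ρ κ φ θ) := by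
    simp only [dotProduct, Matrix.mulVec]
    exact integrable_finsetSum _ fun p _ ↦ (integrable_finsetSum _ fun q _ ↦
      (integrable_familyInfo hφ hL hs θ p q).mul_const _).const_mul _
  have h1 := (integral_eq_zero_iff_of_nonneg hnn hint).1 h0
  -- Any fixed ranking would do; with the identity, ranked features are the features in their
  -- original order, as in `hident`.
  filter_upwards [ae_of_ae_obsLaw hφ h1 1] with x hx j k
  exact inner_sub_eq_zero_of_dotProduct_familyInfo hs hconn hx j k

/-- Asymptotic normality of the minimizers of a sum of choice losses. -/
theorem tendstoInDistribution_familyLoss_minimizer {ρ : Measure S} {κ : Kernel S (Fin K → A)}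
    {φ : S → A → Vec d} (hφ : Measurable fun p : S × A ↦ φ p.1 p.2)
    {L : ℝ} (hL0 : 0 ≤ L) (hL : ∀ s a, ‖φ s a‖ ≤ L)
    {Ω : Type*} [MeasurableSpace Ω] {P : Measure Ω} [IsProbabilityMeasure P]
    {θ₀ : Vec d} {Z : ℕ → Ω → Obs S A K} (hZ : ∀ i, HasLaw (Z i) (obsLaw ρ κ φ θ₀) P)
    (hindep : iIndepFun Z P) {W : Submodule ℝ (Vec d)} {B : ℝ} (hθW : θ₀ ∈ W) (hθB : ‖θ₀‖ < B)
    (hs : ∀ c, (s c).Nonempty) (w : I → Fin K)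
    (hpos : PosOn W (expMatrix (obsLaw ρ κ φ θ₀) fun z ↦ familyInfo T s θ₀ (rankedFeature φ z)))
    (hmean : ∀ t : Vec d,
      ∫ z, inner ℝ t (familyScore T s w θ₀ (rankedFeature φ z)) ∂(obsLaw ρ κ φ θ₀) = 0)
    {J : Matrix (Fin d) (Fin d) ℝ} (hJ : J.IsSymm)
    (hcov : ∀ t : Vec d, t.ofLp ⬝ᵥ (J *ᵥ t.ofLp) =
      ∫ z, (inner ℝ t (familyScore T s w θ₀ (rankedFeature φ z))) ^ 2 ∂(obsLaw ρ κ φ θ₀))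
    {θ : ℕ → Ω → Vec d} (hθm : ∀ n, AEMeasurable (θ n) P)
    {loss : (n : ℕ) → (ℕ → Obs S A K) → Vec d → ℝ}
    (hloss : ∀ n z v, loss n z v =
      1 / (n : ℝ) * ∑ i ∈ Finset.range n, familyLoss T s w (rankedFeature φ (z i)) v)
    (hθ : ∀ n, ∀ᵐ ω ∂P, θ n ω ∈ paramSet W B ∧
      IsMinOn (loss n fun i ↦ Z i ω) (paramSet W B) (θ n ω)) :
    TendstoInDistribution (fun (n : ℕ) ω ↦ Real.sqrt n • (θ n ω - θ₀)) atTop id (fun _ ↦ P)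
      (multivariateGaussian 0
        (invOn W (expMatrix (obsLaw ρ κ φ θ₀) fun z ↦ familyInfo T s θ₀ (rankedFeature φ z)) * J *
          invOn W (expMatrix (obsLaw ρ κ φ θ₀) fun z ↦
            familyInfo T s θ₀ (rankedFeature φ z)))) := by
  obtain ⟨C, hC⟩ := exists_norm_le_of_continuous (K := K) hL
    (continuous_familyScore (T := T) hs w θ₀)
  have hcont := fun p q ↦ continuous_familyInfo (T := T) hs θ₀ p q
  choose C' hC' using fun p q ↦ exists_norm_le_of_continuous (K := K) hL (hcont p q)
  have hb : ∀ (z : Obs S A K) p q,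
      |familyInfo T s θ₀ (rankedFeature φ z) p q| ≤ ∑ p, ∑ q, |C' p q| := fun z p q ↦ by
    refine (hC' p q z).trans ((le_abs_self _).trans ?_)
    refine le_trans ?_ (Finset.single_le_sum (f := fun p ↦ ∑ q, |C' p q|)
      (fun _ _ ↦ Finset.sum_nonneg fun _ _ ↦ abs_nonneg _) (Finset.mem_univ p))
    exact Finset.single_le_sum (f := fun q ↦ |C' p q|) (fun _ _ ↦ abs_nonneg _) (Finset.mem_univ q)
  refine tendstoInDistribution_of_convex_minimizer hZ hindep hθW hθB
    (ℓ := fun z ↦ familyLoss T s w (rankedFeature φ z)) (fun z ↦ convexOn_familyLoss hs w _)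
    (ψ := fun z ↦ familyScore T s w θ₀ (rankedFeature φ z))
    ((continuous_familyScore hs w θ₀).measurable.comp (measurable_rankedFeature hφ)) hC
    (fun p q ↦ (hcont p q).measurable.comp (measurable_rankedFeature hφ)) hb
    (D := T.card * (6 * L ^ 3)) (by positivity)
    (fun z h ↦ abs_familyLoss_taylor_le hs w (fun k ↦ hL _ _) θ₀ h) hmean
    (isSymm_expMatrix fun z ↦ isSymm_familyInfo _ _) hpos hJ hcov hθm fun n ↦ ?_
  filter_upwards [hθ n] with ω hω
  refine ⟨hω.1, fun v hv ↦ ?_⟩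
  -- For `n = 0` the factor `1 / n` is zero and cannot be cancelled, but the empty sum is minimized
  -- everywhere.
  rcases Nat.eq_zero_or_pos n with rfl | hn
  · simp
  · have h := hω.2 hv
    simp only [Set.mem_ofPred_eq, hloss] at h ⊢
    exact le_of_mul_le_mul_left h (by positivity)

end Family

/-! ### The two likelihoods as sums of choice losses -/

section Estimators

variable {S A : Type*} {d K : ℕ}

/-! ### The full ranking likelihood as a sum of choice losses -/

theorem lossK_eq (φ : S → A → Vec d) (n : ℕ) (z : ℕ → Obs S A K) (θ : Vec d) :
    lossK φ n z θ = 1 / (n : ℝ) * ∑ i ∈ Finset.range n,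
      familyLoss Finset.univ Finset.Ici id (rankedFeature φ (z i)) θ := by
  rw [lossK, neg_mul, ← mul_neg]
  simp only [← Finset.sum_neg_distrib, neg_log_exp_div (sum_exp_pos Finset.nonempty_Ici _)]
  rfl

/-- The sign is that of the negative log-likelihood; the centering and information identities are
insensitive to it. -/
theorem inner_familyScore_Ici (φ : S → A → Vec d) (θ t : Vec d) (s : S) (a : Fin K → A)
    (σ : Equiv.Perm (Fin K)) :
    inner ℝ t (familyScore Finset.univ Finset.Ici id θ (rankedFeature φ ((s, a), σ))) =
      -plScore (fun k ↦ inner ℝ θ (φ s (a k))) (fun k ↦ inner ℝ t (φ s (a k))) σ 0 := by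
  simp only [familyScore, inner_sum, inner_blockScore Finset.nonempty_Ici, plScore,
    ← Finset.sum_neg_distrib, neg_sub]
  rfl

theorem dotProduct_familyInfo_Ici (φ : S → A → Vec d) (θ t : Vec d) (s : S) (a : Fin K → A)
    (σ : Equiv.Perm (Fin K)) :
    t.ofLp ⬝ᵥ (familyInfo Finset.univ Finset.Ici θ (rankedFeature φ ((s, a), σ)) *ᵥ t.ofLp) =
      plInfo (fun k ↦ inner ℝ θ (φ s (a k))) (fun k ↦ inner ℝ t (φ s (a k))) σ 0 := by
  simp only [familyInfo, Matrix.sum_mulVec, dotProduct_sum,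
    dotProduct_blockInfo_mulVec Finset.nonempty_Ici, plInfo]
  rfl

/-! ### The pairwise likelihood as a sum of choice losses -/

/-- The pairs of positions `j < k`. -/
def posPairs (K : ℕ) : Finset (Σ _ : Fin K, Fin K) := Finset.univ.sigma fun j ↦ Finset.Ioi j

/-- The two positions of a pair. -/
def pairBlock (c : Σ _ : Fin K, Fin K) : Finset (Fin K) := {c.1, c.2}

theorem pairBlock_nonempty (c : Σ _ : Fin K, Fin K) : (pairBlock c).Nonempty :=
  Finset.insert_nonempty _ _

theorem sum_posPairs {M : Type*} [AddCommMonoid M] (f : Fin K → Fin K → M) :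
    ∑ c ∈ posPairs K, f c.1 c.2 = ∑ j, ∑ k ∈ Finset.Ioi j, f j k :=
  (Finset.sum_sigma' _ _ _).symm

theorem sum_pairBlock {M : Type*} [AddCommMonoid M] {j k : Fin K} (hjk : j ≠ k) (f : Fin K → M) :
    ∑ l ∈ pairBlock ⟨j, k⟩, f l = f j + f k :=
  Finset.sum_pair hjk

theorem lossPair_eq (φ : S → A → Vec d) (n : ℕ) (z : ℕ → Obs S A K) (θ : Vec d) :
    lossPair φ n z θ = 1 / (n : ℝ) * ∑ i ∈ Finset.range n,
      familyLoss (posPairs K) pairBlock Sigma.fst (rankedFeature φ (z i)) θ := by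
  rw [lossPair, neg_mul, ← mul_neg, ← Finset.sum_neg_distrib]
  congr 1
  refine Finset.sum_congr rfl fun i _ ↦ ?_
  rw [familyLoss, sum_posPairs fun j k ↦ blockLoss (pairBlock ⟨j, k⟩) j (rankedFeature φ (z i)) θ,
    ← Finset.sum_neg_distrib]
  refine Finset.sum_congr rfl fun j _ ↦ ?_
  rw [← Finset.sum_neg_distrib]
  refine Finset.sum_congr rfl fun k hk ↦ ?_
  rw [neg_log_exp_div (by positivity), blockLoss, logSumExp,
    sum_pairBlock (Finset.mem_Ioi.1 hk).ne]

theorem exp_neg_div_one_add (x y : ℝ) :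
    Real.exp (-(x - y)) / (1 + Real.exp (-(x - y))) =
      Real.exp y / (Real.exp x + Real.exp y) := by
  rw [neg_sub, Real.exp_sub]
  field_simp

theorem exp_neg_div_one_add_sq (x y : ℝ) :
    Real.exp (-(x - y)) / (1 + Real.exp (-(x - y))) ^ 2 =
      Real.exp (x + y) / (Real.exp x + Real.exp y) ^ 2 := by
  rw [neg_sub, Real.exp_sub, Real.exp_add]
  field_simp

theorem outer_neg (x : Vec d) : outer (-x) = outer x := by
  simp [outer, Matrix.neg_vecMulVec, Matrix.vecMulVec_neg]

theorem outer_zero : outer (0 : Vec d) = 0 := by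
  simp [outer]

/-- In a two-item block the ordered pairs `(j, k)` and `(k, j)` contribute equally, which cancels
the `2` in the denominator. The diagonal term `k = j` of `infoPair` is zero, so `Ici` and `Ioi` give
the same sum. -/
theorem familyInfo_pairBlock (φ : S → A → Vec d) (θ : Vec d) :
    (fun z : Obs S A K ↦ familyInfo (posPairs K) pairBlock θ (rankedFeature φ z)) =
      infoPair φ θ := by
  ext1 z
  rw [familyInfo, infoPair,
    sum_posPairs fun j k ↦ blockInfo (pairBlock ⟨j, k⟩) (rankedFeature φ z) θ]
  refine Finset.sum_congr rfl fun j _ ↦ ?_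
  rw [← Finset.sum_Ioi_add_eq_sum_Ici]
  simp only [rankedDiff, sub_self, outer_zero, smul_zero, add_zero]
  refine Finset.sum_congr rfl fun k hk ↦ ?_
  have hne := (Finset.mem_Ioi.1 hk).ne
  rw [blockInfo, sum_pairBlock hne, sum_pairBlock hne, sum_pairBlock hne, sum_pairBlock hne,
    sub_self, sub_self, outer_zero, smul_zero, smul_zero, zero_add, add_zero,
    ← neg_sub (rankedFeature φ z j), outer_neg, ← add_smul, inner_sub_right,
    exp_neg_div_one_add_sq, inner_add_right, inner_add_right,
    add_comm (inner ℝ θ (rankedFeature φ z k))]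
  congr 1
  field_simp
  ring

theorem familyScore_pairBlock (φ : S → A → Vec d) (θ : Vec d) (z : Obs S A K) :
    familyScore (posPairs K) pairBlock Sigma.fst θ (rankedFeature φ z) = -scorePair φ θ z := by
  rw [familyScore, scorePair,
    sum_posPairs fun j k ↦ blockScore (pairBlock ⟨j, k⟩) j (rankedFeature φ z) θ,
    ← Finset.sum_neg_distrib]
  refine Finset.sum_congr rfl fun j _ ↦ ?_
  rw [← Finset.sum_neg_distrib]
  refine Finset.sum_congr rfl fun k hk ↦ ?_
  have hne := (Finset.mem_Ioi.1 hk).ne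
  rw [blockScore, sum_pairBlock hne, sum_pairBlock hne, sub_self, smul_zero, zero_add, rankedDiff,
    inner_sub_right, exp_neg_div_one_add, ← smul_neg, neg_sub]

theorem exists_mem_posPairs (j k : Fin K) (hjk : j ≠ k) :
    ∃ c ∈ posPairs K, j ∈ pairBlock c ∧ k ∈ pairBlock c := by
  rcases hjk.lt_or_gt with h | h
  · exact ⟨⟨j, k⟩, by simpa [posPairs] using h, by simp [pairBlock], by simp [pairBlock]⟩
  · exact ⟨⟨k, j⟩, by simpa [posPairs] using h, by simp [pairBlock], by simp [pairBlock]⟩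

/-- With `y` the features along `t`, each comparison contributes `w k (y j - y k) / (w j + w k)`:
the weight of the loser times an antisymmetric function, as `sum_plWeight_mul_pair` requires. -/
theorem sum_plProb_mul_inner_scorePair (φ : S → A → Vec d) (θ t : Vec d) (s : S) (a : Fin K → A) :
    ∑ σ, plProb φ θ s a σ * inner ℝ t (scorePair φ θ ((s, a), σ)) = 0 := by
  set w : Fin K → ℝ := fun i ↦ Real.exp (inner ℝ θ (φ s (a i))) with hw
  set y : Fin K → ℝ := fun i ↦ inner ℝ t (φ s (a i)) with hy
  have h := sum_plWeight_mul_pair w (fun i ↦ Real.exp_pos _)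
    (fun i j ↦ (y i - y j) / (w i + w j)) fun i j ↦ by rw [add_comm (w j)]; ring
  rw [← h]
  refine Finset.sum_congr rfl fun σ _ ↦ ?_
  rw [plProb_eq_plWeight]
  congr 1
  simp only [scorePair, inner_sum, inner_smul_right]
  refine Finset.sum_congr rfl fun j _ ↦ Finset.sum_congr rfl fun k _ ↦ ?_
  simp only [rankedDiff, inner_sub_right, exp_neg_div_one_add]
  simp only [hw, hy, rankedFeature]
  ring

end Estimators

end PlackettLuce

/-! ### Asymptotic normality of both estimators -/

theorem theorem4p3
    {S A : Type*} [MeasurableSpace S] [MeasurableSpace A] {d K : ℕ}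
    -- known bounded features
    (φ : S → A → Vec d) (hφ : Measurable fun p : S × A ↦ φ p.1 p.2)
    (L : ℝ) (hφL : ∀ s a, ‖φ s a‖ ≤ L)
    -- law of the states, and of the actions given the state
    (ρ : Measure S) [IsProbabilityMeasure ρ]
    (κ : Kernel S (Fin K → A)) [IsMarkovKernel κ]
    -- parameter set, and true parameter in its relative interior
    (W : Submodule ℝ (Vec d)) (B : ℝ)
    (θstar : Vec d) (hθW : θstar ∈ W) (hθB : ‖θstar‖ < B)
    -- identifiability: the feature differences of the compared actions determine `v ∈ W`
    (hident : ∀ v ∈ W,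
      (∀ᵐ x ∂(ρ ⊗ₘ κ), ∀ j k : Fin K, inner ℝ v (φ x.1 (x.2 j) - φ x.1 (x.2 k)) = 0) → v = 0)
    -- independent observations from the Plackett-Luce model with parameter `θstar`
    {Ω : Type*} [MeasurableSpace Ω] (P : Measure Ω) [IsProbabilityMeasure P]
    (Z : ℕ → Ω → Obs S A K) (hZ : ∀ i, HasLaw (Z i) (obsLaw ρ κ φ θstar) P)
    (hindep : iIndepFun Z P)
    -- the two estimators: any measurable choice of minimizers
    (θK θ2 : ℕ → Ω → Vec d)
    (hθKm : ∀ n, AEMeasurable (θK n) P) (hθ2m : ∀ n, AEMeasurable (θ2 n) P)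
    (hθK : ∀ n, ∀ᵐ ω ∂P, θK n ω ∈ paramSet W B ∧
      IsMinOn (lossK φ n fun i ↦ Z i ω) (paramSet W B) (θK n ω))
    (hθ2 : ∀ n, ∀ᵐ ω ∂P, θ2 n ω ∈ paramSet W B ∧
      IsMinOn (lossPair φ n fun i ↦ Z i ω) (paramSet W B) (θ2 n ω)) :
    (PosOn W (fisherInfo ρ κ φ θstar) ∧
      TendstoInDistribution (fun (n : ℕ) ω ↦ Real.sqrt n • (θK n ω - θstar)) atTop id
        (fun _ ↦ P) (multivariateGaussian 0 (invOn W (fisherInfo ρ κ φ θstar)))) ∧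
    (PosOn W (sigmaPair ρ κ φ θstar) ∧
      TendstoInDistribution (fun (n : ℕ) ω ↦ Real.sqrt n • (θ2 n ω - θstar)) atTop id
        (fun _ ↦ P) (multivariateGaussian 0
          (invOn W (sigmaPair ρ κ φ θstar) * scoreCovPair ρ κ φ θstar *
            invOn W (sigmaPair ρ κ φ θstar)))) := by
  have hprob : IsProbabilityMeasure (obsLaw ρ κ φ θstar) := by
    rw [← (hZ 0).map_eq]
    exact Measure.isProbabilityMeasure_map (hZ 0).aemeasurable
  -- `L` is not assumed nonnegative, while the constant of the cubic remainder has to be.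
  have hL : ∀ s a, ‖φ s a‖ ≤ |L| := fun s a ↦ (hφL s a).trans (le_abs_self L)
  have hIci : ∀ j : Fin K, (Finset.Ici j).Nonempty := fun j ↦ Finset.nonempty_Ici
  constructor
  · have hsc : ∀ t : Vec d, Continuous fun x : Fin K → Vec d ↦
        (inner ℝ t (familyScore Finset.univ Finset.Ici id θstar x) : ℝ) := fun t ↦
      continuous_const.inner (continuous_familyScore hIci id θstar)
    have hic : ∀ t : Vec d, Continuous fun x : Fin K → Vec d ↦
        t.ofLp ⬝ᵥ (familyInfo Finset.univ Finset.Ici θstar x *ᵥ t.ofLp) := fun t ↦ by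
      have := fun p q ↦ continuous_familyInfo (T := Finset.univ) hIci θstar p q
      simp only [dotProduct, Matrix.mulVec]
      fun_prop
    -- `infoK` is by definition the family Hessian for the blocks `Ici j`; positions `j` and `k`
    -- both lie in the block starting at `min j k`.
    have hpos : PosOn W (fisherInfo ρ κ φ θstar) :=
      posOn_expMatrix_familyInfo (T := Finset.univ) (s := Finset.Ici) hφ hL hident hIci
        fun j k _ ↦ ⟨min j k, Finset.mem_univ _, by simp, by simp⟩
    refine ⟨hpos, ?_⟩
    have hsymm : (fisherInfo ρ κ φ θstar).IsSymm :=
      isSymm_expMatrix fun z ↦ isSymm_familyInfo (T := Finset.univ) (s := Finset.Ici) _ _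
    -- The inverse is written as a sandwich so that the general theorem applies with `J` equal to
    -- the information itself.
    rw [← invOn_mul_mul_invOn hpos]
    refine tendstoInDistribution_familyLoss_minimizer hφ (abs_nonneg L) hL hZ hindep hθW hθB hIci id
      hpos (fun t ↦ ?_) hsymm (fun t ↦ ?_) hθKm (lossK_eq φ) hθK
    · obtain ⟨C, hC⟩ := exists_norm_le_of_continuous hL (hsc t)
      refine integral_obsLaw_eq_zero hφ
        ((hsc t).measurable.comp (measurable_rankedFeature hφ)) hC fun s a ↦ ?_
      have h := sum_plWeight_mul_plScore (fun k ↦ inner ℝ θstar (φ s (a k)))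
        (fun k ↦ inner ℝ t (φ s (a k))) 0
      simp only [zero_mul, add_zero] at h
      simp only [inner_familyScore_Ici, plProb_eq_plWeight, mul_neg, Finset.sum_neg_distrib, h,
        neg_zero]
    -- Observed information and squared score differ for a single ranking, but given the state and
    -- actions their difference has mean zero.
    · have hdc := (hic t).sub ((hsc t).pow 2)
      obtain ⟨C, hC⟩ := exists_norm_le_of_continuous hL hdc
      obtain ⟨C₁, hC₁⟩ := exists_norm_le_of_continuous hL (hic t)
      obtain ⟨C₂, hC₂⟩ := exists_norm_le_of_continuous hL ((hsc t).pow 2)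
      have hm := measurable_rankedFeature (K := K) hφ
      rw [fisherInfo, dotProduct_expMatrix_mulVec (M := infoK φ θstar) fun p q ↦
          integrable_familyInfo (T := Finset.univ) hφ hL hIci θstar p q, ← sub_eq_zero]
      refine (integral_sub
        (Integrable.of_bound ((hic t).measurable.comp hm).aestronglyMeasurable C₁ (.of_forall hC₁))
        (Integrable.of_bound (((hsc t).pow 2).measurable.comp hm).aestronglyMeasurable C₂
          (.of_forall hC₂))).symm.trans ?_
      refine integral_obsLaw_eq_zero hφ (hdc.measurable.comp hm) hC fun s a ↦ ?_
      have h := sum_plWeight_mul_plScore_sq (fun k ↦ inner ℝ θstar (φ s (a k)))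
        (fun k ↦ inner ℝ t (φ s (a k))) 0
      simp only [zero_mul, add_zero] at h
      simp only [Function.comp_apply, Pi.pow_apply, inner_familyScore_Ici,
        dotProduct_familyInfo_Ici, plProb_eq_plWeight, neg_sq, mul_sub,
        Finset.sum_sub_distrib, h, sub_self]
  · have hs := pairBlock_nonempty (K := K)
    have hsc : ∀ t : Vec d, Continuous fun x : Fin K → Vec d ↦
        (inner ℝ t (familyScore (posPairs K) pairBlock Sigma.fst θstar x) : ℝ) := fun t ↦
      continuous_const.inner (continuous_familyScore hs Sigma.fst θstar)
    have hpos' := posOn_expMatrix_familyInfo (θ := θstar) hφ hL hident hs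
      exists_mem_posPairs
    have hpos : PosOn W (sigmaPair ρ κ φ θstar) := by
      rwa [familyInfo_pairBlock] at hpos'
    refine ⟨hpos, ?_⟩
    have key := tendstoInDistribution_familyLoss_minimizer (J := scoreCovPair ρ κ φ θstar) hφ
      (abs_nonneg L) hL hZ hindep hθW hθB hs Sigma.fst hpos' (fun t ↦ ?_)
      (isSymm_expMatrix fun z ↦ isSymm_outer _) (fun t ↦ ?_) hθ2m (lossPair_eq φ) hθ2
    · rwa [familyInfo_pairBlock] at key
    · obtain ⟨C, hC⟩ := exists_norm_le_of_continuous hL (hsc t)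
      refine integral_obsLaw_eq_zero hφ
        ((hsc t).measurable.comp (measurable_rankedFeature hφ)) hC fun s a ↦ ?_
      simp only [familyScore_pairBlock, inner_neg_right, mul_neg, Finset.sum_neg_distrib,
        sum_plProb_mul_inner_scorePair, neg_zero]
    · have hent : ∀ p q, Continuous fun x : Fin K → Vec d ↦
          outer (familyScore (posPairs K) pairBlock Sigma.fst θstar x) p q := fun p q ↦ by
        have := continuous_familyScore (T := posPairs K) hs Sigma.fst θstar
        simp only [outer, Matrix.vecMulVec_apply]
        fun_prop
      rw [scoreCovPair, dotProduct_expMatrix_mulVec fun p q ↦ ?_]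
      · simp only [dotProduct_outer_mulVec, familyScore_pairBlock, inner_neg_right, neg_sq]
      · obtain ⟨C, hC⟩ := exists_norm_le_of_continuous (K := K) hL (hent p q)
        have := Integrable.of_bound (μ := obsLaw ρ κ φ θstar)
          ((hent p q).measurable.comp (measurable_rankedFeature hφ)).aestronglyMeasurable C
          (.of_forall hC)
        refine this.congr (.of_forall fun z ↦ ?_)
        simp only [Function.comp_apply, familyScore_pairBlock, outer_neg]
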